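/- Let $R$ be a commutative ring with unit, let $B$ be a finite Boolean lattice of rank $r$, i.e. a poset with an isomorphism to the lattice of subsets of $\{1,\dots,r\}$, with atoms $a_1,\dots,a_r$ ordered accordingly and maximal element $1$, and let $F$ be a colouring of $B$, i.e. a covariant functor from $B$ (viewed as a category with a unique morphism $x\to y$ whenever $x\le y$) to the category of $R$-modules. If $y$ covers $x$ (written $x<_c y$) and $y=x\vee a_\ell$, put $\varepsilon(x<_c y)=(-1)^j$, where $j$ is the number of atoms $a_i\le y$ with $i<\ell$; for a saturated sequence $\mathbf x=(x_1<_c\cdots<_c x_m)$ put $\varepsilon_{\mathbf x}=\prod_i\varepsilon(x_i<_c x_{i+1})$. The cube complex $K_*(B,F)$ has $K_k=\bigoplus_{\mathrm{rk}\,x=r-k}F(x)$ and $d(\lambda)=\sum_{y:\,x<_c y}\varepsilon(x<_c y)\,F(x\le y)(\lambda)$ for $\lambda\in F(x)$. The complex $C_*(B,F)$ has $C_0=F(1)$ and, for $k>0$, $C_k=\bigoplus F(x_1)$, the sum over all sequences $x_1<x_2<\cdots<x_k$ in $B\setminus\{1\}$; an element $\lambda\in F(x_1)$ of the summand of $x_1<\cdots<x_k$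 is written $\lambda\,x_1\cdots x_k$. Its differential is $$d(\lambda\,x_1\cdots x_k)=F(x_1\le x_2)(\lambda)\,x_2\cdots x_k-\sum_{i=2}^k(-1)^i\lambda\,x_1\cdots\widehat{x_i}\cdots x_k\quad(k>1),\qquad d(\lambda\,x)=F(x\le 1)(\lambda)\quad(k=1).$$ Let $\phi:K_*(B,F)\to C_*(B,F)$ be the chain map given, for $\lambda\in F(x)$, by $\phi(\lambda)=\sum_{\mathbf x}\varepsilon_{\mathbf x}\,\lambda\,\mathbf x^\circ$, the sum over all saturated sequences $\mathbf x$ from $x$ to $1$, where $\mathbf x^\circ$ is $\mathbf x$ with its last entry $1$ omitted. If $F(x)$ is a projective $R$-module for every $x\in B$, then $\phi$ is a chain homotopy equivalence. In particular, if $R$ is a field, then $\phi$ is a chain homotopy equivalence. -/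

import Mathlib

open CategoryTheory

open scoped DirectSum

universe u v w

namespace ColouredPoset

noncomputable section

section Term

variable {R : Type w} [CommRing R] {P : Type u} [PartialOrder P]

/-- For a functor `F` from a poset to `R`-modules and a family of elements `a i` of the poset, the
map `F p → ⨁ i, F (a i)` given by `l ↦ F (p ≤ a i) l`, placed in the summand of index `i`.
If `p = a i` this is the inclusion of the summand. -/
def term (F : P ⥤ ModuleCat.{v} R) {ι : Type u} [DecidableEq ι] (a : ι → P) {p : P} (i : ι)
    (h : p ≤ a i) : F.obj p →ₗ[R] ⨁ i, F.obj (a i) :=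
  (DirectSum.lof R ι (fun i => F.obj (a i)) i) ∘ₗ (F.map (homOfLE h)).hom

theorem term_congr (F : P ⥤ ModuleCat.{v} R) {ι : Type u} [DecidableEq ι] (a : ι → P) {p : P}
    {i j : ι} (hij : i = j) (h : p ≤ a i) (h' : p ≤ a j) : term F a i h = term F a j h' := by
  subst hij; rfl

theorem term_map (F : P ⥤ ModuleCat.{v} R) {ι : Type u} [DecidableEq ι] (a : ι → P)
    {p q : P} (i : ι) (h : q ≤ a i) (h' : p ≤ q) (l : F.obj p) :
    term F a i h ((F.map (homOfLE h')).hom l) = term F a i (h'.trans h) l := by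
  simp only [term, LinearMap.comp_apply]
  rw [← LinearMap.comp_apply (F.map (homOfLE h)).hom, ← ModuleCat.hom_comp, ← F.map_comp,
    homOfLE_comp]

theorem toModule_term (F : P ⥤ ModuleCat.{v} R) {ι : Type u} [DecidableEq ι] (a : ι → P)
    {p : P} (i : ι) (h : p ≤ a i) {N : Type*} [AddCommGroup N] [Module R N]
    (f : ∀ i, F.obj (a i) →ₗ[R] N) (l : F.obj p) :
    DirectSum.toModule R ι N f (term F a i h l) = f i ((F.map (homOfLE h)).hom l) := by
  simp [term]

end Term

section OrdSeq

variable {P : Type u} [PartialOrder P] [OrderTop P]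

variable (P) in
/-- The ordered sequences `x_1 < ... < x_k` of length `k` in `P ∖ 1`, written with the maximal
element `1 = ⊤` appended: `x 0 < ... < x (k - 1) < x k = ⊤`. There is exactly one such sequence of
length `k = 0`, and its first entry `x 0` is `⊤`. -/
@[ext]
structure OrdSeq (k : ℕ) : Type u where
  seq : Fin (k + 1) → P
  strictMono : StrictMono seq
  last_eq : seq (Fin.last k) = ⊤

instance (k : ℕ) : DecidableEq (OrdSeq P k) := Classical.decEq _

/-- Delete the `i`-th entry of a sequence, counting from `0`; the appended `⊤` is never deleted. -/
def OrdSeq.face {k : ℕ} (x : OrdSeq P (k + 1)) (i : Fin (k + 1)) : OrdSeq P k :=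
  ⟨x.seq ∘ i.castSucc.succAbove, x.strictMono.comp (Fin.strictMono_succAbove _), by
    simp [Fin.succAbove_of_le_castSucc, Fin.le_last, x.last_eq]⟩

/-- The first entry. -/
def OrdSeq.first {k : ℕ} (x : OrdSeq P k) : P := x.seq 0

theorem OrdSeq.first_le_face {k : ℕ} (x : OrdSeq P (k + 1)) (i : Fin (k + 1)) :
    x.first ≤ (x.face i).first :=
  x.strictMono.monotone (Fin.zero_le _)

theorem OrdSeq.face_face {k : ℕ} (x : OrdSeq P (k + 2)) (i : Fin (k + 1)) (j : Fin (k + 1))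
    (h : i ≤ j) : (x.face j.succ).face i = (x.face i.castSucc).face j := by
  apply OrdSeq.ext
  funext m
  simp only [OrdSeq.face, Function.comp]
  congr 1
  ext
  simp only [Fin.succAbove, Fin.lt_def, Fin.le_def] at *
  grind

end OrdSeq

section PosetComplex

variable {R : Type w} [CommRing R] {P : Type u} [PartialOrder P] [OrderTop P]

/-- The chain module: one summand `F (x_1)` for each ordered sequence `x_1 < ... < x_k` in
`P ∖ 1`, and `F 1` for `k = 0`. -/
abbrev chainModule (F : P ⥤ ModuleCat.{v} R) (k : ℕ) : ModuleCat.{max u v} R :=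
  ModuleCat.of R (⨁ x : OrdSeq P k, F.obj x.first)

/-- The differential
`d (l x_1 ... x_k) = F (x_1 ≤ x_2) (l) x_2 ... x_k - ∑_{i = 2}^k (-1)^i l x_1 ... x̂_i ... x_k`
for `k > 1`, and `d (l x) = F (x ≤ 1) (l)` for `k = 1`. Entries are counted from `0` here. -/
def chainDifferential (F : P ⥤ ModuleCat.{v} R) (k : ℕ) :
    chainModule F (k + 1) ⟶ chainModule F k :=
  ModuleCat.ofHom <| DirectSum.toModule R _ _ fun x : OrdSeq P (k + 1) =>
    ∑ i : Fin (k + 1), ((-1 : ℤ) ^ (i : ℕ)) • term F OrdSeq.first (x.face i) (x.first_le_face i)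

theorem chainDifferential_comp (F : P ⥤ ModuleCat.{v} R) (k : ℕ) :
    chainDifferential F (k + 1) ≫ chainDifferential F k = 0 := by
  apply ModuleCat.hom_ext
  apply DirectSum.linearMap_ext
  intro x
  have key : ∀ (i : Fin (k + 2)) (j : Fin (k + 1)), x.first ≤ ((x.face i).face j).first :=
    fun i j => (x.first_le_face i).trans ((x.face i).first_le_face j)
  have h1 : (chainDifferential F (k + 1) ≫ chainDifferential F k).hom ∘ₗ
      DirectSum.lof R (OrdSeq P (k + 2)) (fun x => F.obj x.first) x =
      ∑ p : Fin (k + 2) × Fin (k + 1), ((-1 : ℤ) ^ (p.1 + p.2 : ℕ)) •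
        term F OrdSeq.first ((x.face p.1).face p.2) (key p.1 p.2) := by
    ext1 l
    simp only [chainDifferential, ModuleCat.hom_comp, ModuleCat.hom_ofHom, LinearMap.comp_apply,
      DirectSum.toModule_lof, LinearMap.sum_apply, LinearMap.smul_apply, map_sum, map_zsmul,
      Fintype.sum_prod_type, pow_add, mul_smul]
    refine Finset.sum_congr rfl fun i _ => ?_
    rw [toModule_term, LinearMap.sum_apply, Finset.smul_sum]
    refine Finset.sum_congr rfl fun j _ => ?_
    rw [LinearMap.smul_apply, term_map]
  rw [h1]
  simp only [ModuleCat.hom_zero, LinearMap.zero_comp]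
  let S : Finset (Fin (k + 2) × Fin (k + 1)) :=
    Finset.univ.filter fun p => (p.2 : ℕ) < (p.1 : ℕ)
  rw [← Finset.sum_add_sum_compl S, add_eq_zero_iff_eq_neg, ← Finset.sum_neg_distrib]
  refine Finset.sum_bij
    (fun p hp => (p.2.castSucc, p.1.pred (by
      have := (Finset.mem_filter.1 hp).2
      intro h0; rw [h0] at this; simp at this))) ?_ ?_ ?_ ?_
  · rintro ⟨i, j⟩ hp
    have h := (Finset.mem_filter.1 hp).2
    simp only [S, Finset.mem_compl, Finset.mem_filter, Finset.mem_univ, true_and, not_lt,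
      Fin.val_pred, Fin.val_castSucc] at h ⊢
    omega
  · rintro ⟨i, j⟩ hp ⟨i', j'⟩ hp' h
    have h1 := (Finset.mem_filter.1 hp).2
    have h2 := (Finset.mem_filter.1 hp').2
    simp only [Prod.mk.injEq, Fin.ext_iff, Fin.val_pred, Fin.val_castSucc] at h h1 h2 ⊢
    omega
  · rintro ⟨i, j⟩ hp
    simp only [S, Finset.mem_compl, Finset.mem_filter, Finset.mem_univ, true_and, not_lt] at hp
    refine ⟨(j.succ, i.castLT (by omega)), ?_, ?_⟩
    · simp only [S, Finset.mem_filter, Finset.mem_univ, true_and, Fin.val_succ, Fin.val_castLT]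
      omega
    · simp
  · rintro ⟨i, j⟩ hp
    have h := (Finset.mem_filter.1 hp).2
    obtain ⟨i, rfl⟩ : ∃ i' : Fin (k + 1), i = i'.succ :=
      ⟨i.pred (by intro h0; rw [h0] at h; simp at h), by simp⟩
    simp only [Fin.val_succ] at h
    have hface := OrdSeq.face_face x j i (by rw [Fin.le_def]; omega)
    simp only [Fin.pred_succ, Fin.val_succ, Fin.val_castSucc]
    rw [← neg_smul, term_congr F OrdSeq.first hface _ (key j.castSucc i)]
    congr 1
    ring

/-- The complex of the coloured poset `(P, F)` built from the ordered sequences in `P ∖ 1`. -/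
def chainCx (F : P ⥤ ModuleCat.{v} R) : ChainComplex (ModuleCat.{max u v} R) ℕ :=
  ChainComplex.of (chainModule F) (chainDifferential F) (chainDifferential_comp F)

theorem chainCx_d (F : P ⥤ ModuleCat.{v} R) (k : ℕ) :
    (chainCx F).d (k + 1) k = chainDifferential F k :=
  ChainComplex.of_d _ _ _

end PosetComplex

section Sign

variable {B : Type u} [PartialOrder B] {r : ℕ}

/-- The sign of a covering relation `x ⋖ y` in a Boolean lattice `B`, identified by `e` with the
lattice of subsets of the ordered set `{0, ..., r - 1}`: if `e y = e x ∪ {l}` then the sign is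
`(-1) ^ j` where `j` is the number of elements of `e y` that come before `l`. -/
def sign (e : B ≃o Finset (Fin r)) (x y : B) : ℤ :=
  ∏ l ∈ e y \ e x, (-1) ^ ((e y).filter (· < l)).card

/-- The fourth vertex of the square spanned by `x ⋖ y ⋖ z`. -/
def other (e : B ≃o Finset (Fin r)) (x y z : B) : B :=
  e.symm (e x ∪ (e z \ e y))

theorem exists_of_covBy (e : B ≃o Finset (Fin r)) {x y z : B} (h : x ⋖ y) (h' : y ⋖ z) :
    ∃ a b, a ∉ e x ∧ b ∉ e x ∧ a ≠ b ∧ e y = insert a (e x) ∧ e z = insert b (insert a (e x)) ∧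
      e (other e x y z) = insert b (e x) := by
  rw [← apply_covBy_apply_iff e, Finset.covBy_iff_exists_insert] at h h'
  obtain ⟨a, ha, hay⟩ := h
  obtain ⟨b, hb, hbz⟩ := h'
  rw [← hay, Finset.mem_insert, not_or] at hb
  refine ⟨a, b, ha, hb.2, Ne.symm hb.1, hay.symm, by rw [hay, hbz], ?_⟩
  rw [other, OrderIso.apply_symm_apply, ← hbz, ← hay]
  ext c
  simp only [Finset.mem_union, Finset.mem_sdiff, Finset.mem_insert]
  grind

theorem covBy_other (e : B ≃o Finset (Fin r)) {x y z : B} (h : x ⋖ y) (h' : y ⋖ z) :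
    x ⋖ other e x y z := by
  obtain ⟨a, b, ha, hb, hab, hy, hz, ho⟩ := exists_of_covBy e h h'
  rw [← apply_covBy_apply_iff e, Finset.covBy_iff_exists_insert]
  exact ⟨b, hb, ho.symm⟩

theorem other_covBy (e : B ≃o Finset (Fin r)) {x y z : B} (h : x ⋖ y) (h' : y ⋖ z) :
    other e x y z ⋖ z := by
  obtain ⟨a, b, ha, hb, hab, hy, hz, ho⟩ := exists_of_covBy e h h'
  rw [← apply_covBy_apply_iff e, Finset.covBy_iff_exists_insert]
  refine ⟨a, by simp [ho, ha, hab], ?_⟩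
  rw [ho, hz, Finset.insert_comm]

theorem other_ne (e : B ≃o Finset (Fin r)) {x y z : B} (h : x ⋖ y) (h' : y ⋖ z) :
    other e x y z ≠ y := by
  obtain ⟨a, b, ha, hb, hab, hy, hz, ho⟩ := exists_of_covBy e h h'
  intro heq
  rw [heq, hy] at ho
  have : a ∈ insert b (e x) := ho ▸ Finset.mem_insert_self a _
  simp [ha, hab] at this

theorem other_other (e : B ≃o Finset (Fin r)) {x y z : B} (h : x ⋖ y) (h' : y ⋖ z) :
    other e x (other e x y z) z = y := by
  obtain ⟨a, b, ha, hb, hab, hy, hz, ho⟩ := exists_of_covBy e h h'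
  apply e.injective
  conv_lhs => rw [other, OrderIso.apply_symm_apply, ho, hz]
  rw [hy]
  ext c
  simp only [Finset.mem_union, Finset.mem_sdiff, Finset.mem_insert]
  grind

theorem sign_insert (e : B ≃o Finset (Fin r)) {x y : B} {a : Fin r} (ha : a ∉ e x)
    (h : e y = insert a (e x)) : sign e x y = (-1) ^ ((e x).filter (· < a)).card := by
  rw [sign, h, Finset.insert_sdiff_cancel ha, Finset.prod_singleton, Finset.filter_insert]
  simp

theorem sign_other (e : B ≃o Finset (Fin r)) {x y z : B} (h : x ⋖ y) (h' : y ⋖ z) :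
    sign e x (other e x y z) * sign e (other e x y z) z = -(sign e x y * sign e y z) := by
  obtain ⟨a, b, ha, hb, hab, hy, hz, ho⟩ := exists_of_covBy e h h'
  rw [sign_insert e hb ho, sign_insert e ha hy,
    sign_insert e (x := y) (a := b) (by simp [hy, hb, hab.symm]) (by rw [hy, hz]),
    sign_insert e (x := other e x y z) (a := a) (by simp [ho, ha, hab])
      (by rw [ho, hz, Finset.insert_comm]), hy, ho, Finset.filter_insert, Finset.filter_insert]
  rcases lt_or_gt_of_ne hab with hlt | hlt
  · rw [if_neg (not_lt.2 hlt.le), if_pos hlt, Finset.card_insert_of_notMem (by simp [ha])]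
    ring
  · rw [if_pos hlt, if_neg (not_lt.2 hlt.le), Finset.card_insert_of_notMem (by simp [hb])]
    ring

end Sign

section Cube

variable {B : Type u} [PartialOrder B] {r : ℕ}

/-- The elements `x` of the Boolean lattice with `rk x = r - k` (none if `k > r`). -/
@[ext]
structure CubeIdx (e : B ≃o Finset (Fin r)) (k : ℕ) : Type u where
  elt : B
  card_add : (e elt).card + k = r

instance (e : B ≃o Finset (Fin r)) (k : ℕ) : DecidableEq (CubeIdx e k) := Classical.decEq _

/-- The elements `y` that cover `x`; their rank is automatically one more than that of `x`. -/
@[ext]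
structure Cover {e : B ≃o Finset (Fin r)} {k : ℕ} (x : CubeIdx e (k + 1)) : Type u where
  idx : CubeIdx e k
  covBy : x.elt ⋖ idx.elt

instance {e : B ≃o Finset (Fin r)} {k : ℕ} (x : CubeIdx e (k + 1)) : Fintype (Cover x) :=
  haveI : Finite B := Finite.of_equiv _ e.symm.toEquiv
  haveI : Finite (CubeIdx e k) :=
    Finite.of_injective CubeIdx.elt fun _ _ h => CubeIdx.ext h
  haveI : Finite (Cover x) := Finite.of_injective Cover.idx fun _ _ h => Cover.ext h
  Fintype.ofFinite _

variable {R : Type w} [CommRing R]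

/-- The chain module of the cube complex: the direct sum of the `F x` over all `x` of rank
`r - k`. -/
abbrev cubeModule (e : B ≃o Finset (Fin r)) (F : B ⥤ ModuleCat.{v} R) (k : ℕ) :
    ModuleCat.{max u v} R :=
  ModuleCat.of R (⨁ x : CubeIdx e k, F.obj x.elt)

/-- The differential of the cube complex: `l ∈ F x` is sent to the sum over all `y` covering `x`
of `sign (x ⋖ y) F (x ≤ y) (l)`. -/
def cubeDifferential (e : B ≃o Finset (Fin r)) (F : B ⥤ ModuleCat.{v} R) (k : ℕ) :
    cubeModule e F (k + 1) ⟶ cubeModule e F k :=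
  ModuleCat.ofHom <| DirectSum.toModule R _ _ fun x : CubeIdx e (k + 1) =>
    ∑ y : Cover x, sign e x.elt y.idx.elt • term F CubeIdx.elt y.idx y.covBy.le

theorem card_of_covBy (e : B ≃o Finset (Fin r)) {x y : B} (h : x ⋖ y) :
    (e y).card = (e x).card + 1 := by
  rw [← apply_covBy_apply_iff e, Finset.covBy_iff_exists_insert] at h
  obtain ⟨a, ha, hay⟩ := h
  rw [← hay, Finset.card_insert_of_notMem ha]

theorem cubeDifferential_comp (e : B ≃o Finset (Fin r)) (F : B ⥤ ModuleCat.{v} R) (k : ℕ) :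
    cubeDifferential e F (k + 1) ≫ cubeDifferential e F k = 0 := by
  apply ModuleCat.hom_ext
  apply DirectSum.linearMap_ext
  intro x
  have h1 : (cubeDifferential e F (k + 1) ≫ cubeDifferential e F k).hom ∘ₗ
      DirectSum.lof R (CubeIdx e (k + 2)) (fun x => F.obj x.elt) x =
      ∑ p : (Σ y : Cover x, Cover y.idx),
        (sign e x.elt p.1.idx.elt * sign e p.1.idx.elt p.2.idx.elt) •
          term F CubeIdx.elt p.2.idx (p.1.covBy.le.trans p.2.covBy.le) := by
    ext1 l
    simp only [cubeDifferential, ModuleCat.hom_comp, ModuleCat.hom_ofHom, LinearMap.comp_apply,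
      DirectSum.toModule_lof, LinearMap.sum_apply, LinearMap.smul_apply, map_sum, map_zsmul,
      Fintype.sum_sigma, mul_smul]
    refine Finset.sum_congr rfl fun i _ => ?_
    rw [toModule_term, LinearMap.sum_apply, Finset.smul_sum]
    refine Finset.sum_congr rfl fun j _ => ?_
    rw [LinearMap.smul_apply, term_map]
  rw [h1]
  simp only [ModuleCat.hom_zero, LinearMap.zero_comp]
  refine Finset.sum_involution (fun p _ =>
    ⟨⟨⟨other e x.elt p.1.idx.elt p.2.idx.elt, by
        have h2 := card_of_covBy e (covBy_other e p.1.covBy p.2.covBy)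
        have h3 := x.card_add
        omega⟩, covBy_other e p.1.covBy p.2.covBy⟩, ⟨p.2.idx, other_covBy e p.1.covBy p.2.covBy⟩⟩) ?_ ?_ ?_ ?_
  · intro p _
    change _ + (sign e x.elt (other e x.elt p.1.idx.elt p.2.idx.elt) *
      sign e (other e x.elt p.1.idx.elt p.2.idx.elt) p.2.idx.elt) • _ = 0
    rw [sign_other e p.1.covBy p.2.covBy, neg_smul]
    exact add_neg_cancel _
  · intro p _ _ heq
    exact other_ne e p.1.covBy p.2.covBy (congrArg (fun q : (Σ y : Cover x, Cover y.idx) => q.1.idx.elt) heq)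
  · intro p _
    exact Finset.mem_univ _
  · rintro ⟨⟨⟨y, hy⟩, hxy⟩, ⟨z, hyz⟩⟩ _
    have h4 := other_other e hxy hyz
    have h5 : ∀ (y' : B) (h1 : (e y').card + (k + 1) = r) (h2 : x.elt ⋖ y') (h3 : y' ⋖ z.elt),
        y' = y → (⟨⟨⟨y', h1⟩, h2⟩, ⟨z, h3⟩⟩ : Σ y : Cover x, Cover y.idx) =
          ⟨⟨⟨y, hy⟩, hxy⟩, ⟨z, hyz⟩⟩ := by
      rintro _ _ _ _ rfl; rfl
    exact h5 _ _ _ _ h4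

/-- The cube complex of the coloured Boolean lattice `(B, F)`. -/
def cubeCx (e : B ≃o Finset (Fin r)) (F : B ⥤ ModuleCat.{v} R) :
    ChainComplex (ModuleCat.{max u v} R) ℕ :=
  ChainComplex.of (cubeModule e F) (cubeDifferential e F) (cubeDifferential_comp e F)

theorem cubeCx_d (e : B ≃o Finset (Fin r)) (F : B ⥤ ModuleCat.{v} R) (k : ℕ) :
    (cubeCx e F).d (k + 1) k = cubeDifferential e F k :=
  ChainComplex.of_d _ _ _

end Cube

section Swap

variable {B : Type u} [PartialOrder B] {r : ℕ}

/-- Replace an inner entry of a saturated sequence by the other possible one. -/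
def swapFun (e : B ≃o Finset (Fin r)) {k : ℕ} (c : Fin (k + 2) → B) (i : Fin k) :
    Fin (k + 2) → B :=
  Function.update c i.succ.castSucc
    (other e (c i.castSucc.castSucc) (c i.succ.castSucc) (c i.succ.succ))

theorem swapFun_self (e : B ≃o Finset (Fin r)) {k : ℕ} (c : Fin (k + 2) → B) (i : Fin k) :
    swapFun e c i i.succ.castSucc =
      other e (c i.castSucc.castSucc) (c i.succ.castSucc) (c i.succ.succ) :=
  Function.update_self _ _ _

theorem swapFun_of_ne (e : B ≃o Finset (Fin r)) {k : ℕ} (c : Fin (k + 2) → B) (i : Fin k)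
    {j : Fin (k + 2)} (h : (j : ℕ) ≠ i + 1) : swapFun e c i j = c j :=
  Function.update_of_ne (by rw [Ne, Fin.ext_iff]; simpa using h) _ _

theorem swapFun_covBy (e : B ≃o Finset (Fin r)) {k : ℕ} (c : Fin (k + 2) → B) (i : Fin k)
    (hc : ∀ j : Fin (k + 1), c j.castSucc ⋖ c j.succ) (j : Fin (k + 1)) :
    swapFun e c i j.castSucc ⋖ swapFun e c i j.succ := by
  have h1 : c i.castSucc.castSucc ⋖ c i.succ.castSucc := hc i.castSucc
  have h2 : c i.succ.castSucc ⋖ c i.succ.succ := hc i.succ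
  by_cases ha : j = i.castSucc
  · subst ha
    rw [swapFun_of_ne (j := i.castSucc.castSucc) (h := by simp), Fin.succ_castSucc,
      swapFun_self]
    exact covBy_other e h1 h2
  by_cases hb : j = i.succ
  · subst hb
    rw [swapFun_of_ne (j := i.succ.succ) (h := by simp), swapFun_self]
    exact other_covBy e h1 h2
  rw [Fin.ext_iff] at ha hb
  simp only [Fin.val_castSucc, Fin.val_succ] at ha hb
  rw [swapFun_of_ne _ _ _ (by simpa using hb), swapFun_of_ne _ _ _ (by simpa using ha)]
  exact hc j

end Swap

section Phi

variable {B : Type u} [PartialOrder B] [OrderTop B] {r : ℕ}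

/-- The saturated sequences from `x` to `1`, for `x` of rank `r - k`; such a sequence has `k + 1`
entries, the last of which is `1 = ⊤`. Omitting the final `1` gives the sequence in `B ∖ 1` that
`OrdSeq` encodes. -/
@[ext]
structure SatSeq {e : B ≃o Finset (Fin r)} {k : ℕ} (x : CubeIdx e k) : Type u where
  ord : OrdSeq B k
  first_eq : ord.first = x.elt
  covBy : ∀ i : Fin k, ord.seq i.castSucc ⋖ ord.seq i.succ

instance {e : B ≃o Finset (Fin r)} {k : ℕ} (x : CubeIdx e k) : Fintype (SatSeq x) :=
  haveI : Finite B := Finite.of_equiv _ e.symm.toEquiv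
  haveI : Finite (OrdSeq B k) := Finite.of_injective OrdSeq.seq fun _ _ h => OrdSeq.ext h
  haveI : Finite (SatSeq x) := Finite.of_injective SatSeq.ord fun _ _ h => SatSeq.ext h
  Fintype.ofFinite _

/-- The product of the signs of the consecutive covering relations of a saturated sequence. -/
def seqSign (e : B ≃o Finset (Fin r)) {k : ℕ} (c : OrdSeq B k) : ℤ :=
  ∏ i : Fin k, sign e (c.seq i.castSucc) (c.seq i.succ)

variable {R : Type w} [CommRing R]

/-- The map `phi` from the cube complex in degree `k`: `l ∈ F x` is sent to the signed sum of the
`l · c` over all saturated sequences `c` from `x` to `1`, with the final `1` of `c` omitted. -/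
def phiMap (e : B ≃o Finset (Fin r)) (F : B ⥤ ModuleCat.{v} R) (k : ℕ) :
    cubeModule e F k ⟶ chainModule F k :=
  ModuleCat.ofHom <| DirectSum.toModule R _ _ fun x : CubeIdx e k =>
    ∑ c : SatSeq x, seqSign e c.ord • term F OrdSeq.first c.ord c.first_eq.ge

theorem OrdSeq.succ_face_zero {k : ℕ} (c : OrdSeq B (k + 1)) (i : Fin (k + 1)) :
    (c.face 0).seq i = c.seq i.succ := by
  simp [OrdSeq.face]

/-- Remove the first entry of a saturated sequence. -/
def SatSeq.tail {e : B ≃o Finset (Fin r)} {k : ℕ} {x : CubeIdx e (k + 1)} (c : SatSeq x) :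
    Σ y : Cover x, SatSeq y.idx :=
  have h0 : x.elt ⋖ c.ord.seq 1 := by rw [← c.first_eq]; exact c.covBy 0
  ⟨⟨⟨c.ord.seq 1, by
      have h2 := card_of_covBy e h0
      have h3 := x.card_add
      omega⟩, h0⟩,
    ⟨c.ord.face 0, OrdSeq.succ_face_zero _ _, fun i => by
      rw [OrdSeq.succ_face_zero, OrdSeq.succ_face_zero]; exact c.covBy i.succ⟩⟩

theorem SatSeq.sigma_ext {e : B ≃o Finset (Fin r)} {k : ℕ} {x : CubeIdx e (k + 1)}
    (p q : Σ y : Cover x, SatSeq y.idx) (h : p.2.ord = q.2.ord) : p = q := by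
  rcases p with ⟨⟨⟨y, hy⟩, hxy⟩, ⟨c, hc, _⟩⟩
  rcases q with ⟨⟨⟨y', hy'⟩, hxy'⟩, ⟨c', hc', _⟩⟩
  obtain rfl : c = c' := h
  obtain rfl : y = y' := hc.symm.trans hc'
  rfl

theorem SatSeq.tail_bijective {e : B ≃o Finset (Fin r)} {k : ℕ} (x : CubeIdx e (k + 1)) :
    Function.Bijective (SatSeq.tail (x := x)) := by
  constructor
  · intro c c' h
    have h1 : c.ord.face 0 = c'.ord.face 0 :=
      congrArg (fun q : (Σ y : Cover x, SatSeq y.idx) => q.2.ord) h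
    apply SatSeq.ext
    apply OrdSeq.ext
    funext i
    refine Fin.cases ?_ (fun j => ?_) i
    · exact c.first_eq.trans c'.first_eq.symm
    · rw [← OrdSeq.succ_face_zero, ← OrdSeq.succ_face_zero, h1]
  · rintro ⟨y, c⟩
    have hcov : ∀ i : Fin (k + 1), (Fin.cons x.elt c.ord.seq : Fin (k + 2) → B) i.castSucc ⋖
        (Fin.cons x.elt c.ord.seq : Fin (k + 2) → B) i.succ := by
      intro i
      refine Fin.cases ?_ (fun j => ?_) i
      · simp only [Fin.castSucc_zero, Fin.cons_zero, Fin.cons_succ]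
        have h := c.first_eq
        simp only [OrdSeq.first] at h
        rw [h]
        exact y.covBy
      · rw [← Fin.succ_castSucc]
        simp only [Fin.cons_succ]
        exact c.covBy j
    refine ⟨⟨⟨Fin.cons x.elt c.ord.seq, Fin.strictMono_iff_lt_succ.2 fun i => (hcov i).lt, ?_⟩,
      rfl, hcov⟩, ?_⟩
    · rw [← Fin.succ_last, Fin.cons_succ]
      exact c.ord.last_eq
    · apply SatSeq.sigma_ext
      apply OrdSeq.ext
      funext i
      exact OrdSeq.succ_face_zero _ _

/-- Replace an inner entry of a saturated sequence by the other possible one. -/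
def SatSeq.swap {e : B ≃o Finset (Fin r)} {k : ℕ} {x : CubeIdx e (k + 1)} (i : Fin k)
    (c : SatSeq x) : SatSeq x :=
  ⟨⟨swapFun e c.ord.seq i,
    Fin.strictMono_iff_lt_succ.2 fun j => (swapFun_covBy e c.ord.seq i c.covBy j).lt, by
      rw [swapFun_of_ne _ _ _ (by simp [i.2.ne'])]; exact c.ord.last_eq⟩,
    by
      exact (swapFun_of_ne e c.ord.seq i (j := 0) (by simp)).trans c.first_eq,
    swapFun_covBy e c.ord.seq i c.covBy⟩

theorem SatSeq.swap_ne {e : B ≃o Finset (Fin r)} {k : ℕ} {x : CubeIdx e (k + 1)} (i : Fin k)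
    (c : SatSeq x) : c.swap i ≠ c := by
  intro h
  have h3 := congrArg (fun c : SatSeq x => c.ord.seq i.succ.castSucc) h
  simp only [SatSeq.swap, swapFun_self] at h3
  exact other_ne e (c.covBy i.castSucc) (c.covBy i.succ) h3

theorem SatSeq.swap_swap {e : B ≃o Finset (Fin r)} {k : ℕ} {x : CubeIdx e (k + 1)} (i : Fin k)
    (c : SatSeq x) : (c.swap i).swap i = c := by
  apply SatSeq.ext
  apply OrdSeq.ext
  funext j
  by_cases h : (j : ℕ) = i + 1
  · obtain rfl : j = i.succ.castSucc := Fin.ext h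
    simp only [SatSeq.swap]
    rw [swapFun_self, swapFun_self, swapFun_of_ne _ _ _ (by simp),
      swapFun_of_ne _ _ _ (by simp)]
    exact other_other e (c.covBy i.castSucc) (c.covBy i.succ)
  · simp only [SatSeq.swap]
    rw [swapFun_of_ne _ _ _ h, swapFun_of_ne _ _ _ h]

theorem SatSeq.seqSign_swap {e : B ≃o Finset (Fin r)} {k : ℕ} {x : CubeIdx e (k + 1)} (i : Fin k)
    (c : SatSeq x) : seqSign e (c.swap i).ord = -seqSign e c.ord := by
  have hne : i.succ ≠ i.castSucc := by rw [Ne, Fin.ext_iff]; simp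
  have hmem : i.succ ∈ (Finset.univ : Finset (Fin (k + 1))).erase i.castSucc :=
    Finset.mem_erase.2 ⟨hne, Finset.mem_univ _⟩
  unfold seqSign
  rw [← Finset.mul_prod_erase _ _ (Finset.mem_univ i.castSucc), ← Finset.mul_prod_erase _ _ hmem,
    ← Finset.mul_prod_erase (a := i.castSucc) _ _ (Finset.mem_univ _),
    ← Finset.mul_prod_erase _ (fun j : Fin (k + 1) => sign e (c.ord.seq j.castSucc) (c.ord.seq j.succ)) hmem,
    ← mul_assoc, ← mul_assoc, ← neg_mul]
  congr 1
  · simp only [SatSeq.swap]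
    rw [swapFun_of_ne (j := i.castSucc.castSucc) (h := by simp), Fin.succ_castSucc,
      swapFun_self, swapFun_of_ne (j := i.succ.succ) (h := by simp)]
    exact sign_other e (c.covBy i.castSucc) (c.covBy i.succ)
  · refine Finset.prod_congr rfl fun j hj => ?_
    simp only [Finset.mem_erase, Finset.mem_univ, and_true, Fin.ext_iff, Fin.val_succ,
      Fin.val_castSucc, ne_eq] at hj
    simp only [SatSeq.swap]
    rw [swapFun_of_ne _ _ _ (by simpa using hj.1),
      swapFun_of_ne _ _ _ (by simpa using hj.2)]

theorem SatSeq.face_swap {e : B ≃o Finset (Fin r)} {k : ℕ} {x : CubeIdx e (k + 1)} (i : Fin k)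
    (c : SatSeq x) : (c.swap i).ord.face i.succ = c.ord.face i.succ := by
  apply OrdSeq.ext
  funext j
  exact Function.update_of_ne (Fin.succAbove_ne _ _) _ _

theorem phiMap_comm (e : B ≃o Finset (Fin r)) (F : B ⥤ ModuleCat.{v} R) (k : ℕ) :
    phiMap e F (k + 1) ≫ chainDifferential F k = cubeDifferential e F k ≫ phiMap e F k := by
  apply ModuleCat.hom_ext
  apply DirectSum.linearMap_ext
  intro x
  have hle : ∀ (c : SatSeq x) (i : Fin (k + 1)), x.elt ≤ (c.ord.face i).first :=
    fun c i => c.first_eq.ge.trans (c.ord.first_le_face i)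
  ext1 l
  have h1 : ((phiMap e F (k + 1) ≫ chainDifferential F k).hom ∘ₗ
      DirectSum.lof R (CubeIdx e (k + 1)) (fun x => F.obj x.elt) x) l =
      ∑ i : Fin (k + 1), ∑ c : SatSeq x, (seqSign e c.ord * (-1) ^ (i : ℕ)) •
        term F OrdSeq.first (c.ord.face i) (hle c i) l := by
    simp only [chainDifferential, phiMap, ModuleCat.hom_comp, ModuleCat.hom_ofHom,
      LinearMap.comp_apply, DirectSum.toModule_lof, LinearMap.sum_apply, LinearMap.smul_apply,
      map_sum, map_zsmul, mul_smul]
    rw [Finset.sum_comm]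
    refine Finset.sum_congr rfl fun i _ => ?_
    rw [toModule_term, LinearMap.sum_apply, Finset.smul_sum]
    refine Finset.sum_congr rfl fun j _ => ?_
    rw [LinearMap.smul_apply, term_map]
  have h2 : ((cubeDifferential e F k ≫ phiMap e F k).hom ∘ₗ
      DirectSum.lof R (CubeIdx e (k + 1)) (fun x => F.obj x.elt) x) l =
      ∑ p : (Σ y : Cover x, SatSeq y.idx), (sign e x.elt p.1.idx.elt * seqSign e p.2.ord) •
        term F OrdSeq.first p.2.ord (p.1.covBy.le.trans p.2.first_eq.ge) l := by
    simp only [cubeDifferential, phiMap, ModuleCat.hom_comp, ModuleCat.hom_ofHom,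
      LinearMap.comp_apply, DirectSum.toModule_lof, LinearMap.sum_apply, LinearMap.smul_apply,
      map_sum, map_zsmul, mul_smul, Fintype.sum_sigma]
    refine Finset.sum_congr rfl fun i _ => ?_
    rw [toModule_term, LinearMap.sum_apply, Finset.smul_sum]
    refine Finset.sum_congr rfl fun j _ => ?_
    rw [LinearMap.smul_apply, term_map]
  rw [h1, h2, Fin.sum_univ_succ, Finset.sum_eq_zero (s := Finset.univ (α := Fin k)), add_zero]
  · refine Fintype.sum_bijective SatSeq.tail (SatSeq.tail_bijective x) _ _ fun c => ?_
    have hs : seqSign e c.ord = sign e x.elt (c.ord.seq 1) * seqSign e (c.ord.face 0) := by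
      unfold seqSign
      rw [Fin.prod_univ_succ]
      congr 1
      · exact congrArg (fun z => sign e z (c.ord.seq 1)) c.first_eq
    rw [hs]
    simp only [Fin.val_zero, pow_zero, mul_one]
    rfl
  · intro i _
    refine Finset.sum_involution (fun c _ => c.swap i) ?_ ?_ ?_ ?_
    · intro c _
      rw [term_congr F OrdSeq.first (c.face_swap i) (hle (c.swap i) i.succ) (hle c i.succ),
        c.seqSign_swap i, neg_mul, neg_smul]
      exact add_neg_cancel _
    · intro c _ _
      exact c.swap_ne i
    · intro c _
      exact Finset.mem_univ _
    · intro c _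
      exact c.swap_swap i

/-- The chain map `phi` from the cube complex to the complex of the coloured poset. -/
def phi (e : B ≃o Finset (Fin r)) (F : B ⥤ ModuleCat.{v} R) : cubeCx e F ⟶ chainCx F :=
  ChainComplex.ofHom (phiMap e F) fun k => by
    rw [chainCx_d, cubeCx_d]
    exact phiMap_comm e F k

end Phi

end

end ColouredPoset

/-! Both complexes consist of modules `⨁ i, F (a i)`, where the indices `i` form the basis of a free
abelian group and each carries a label `a i` in `B`. The differentials and `phi` are given by
integral matrices that are upper: a nonzero entry from `i` to `j` forces `a i ≤ a j`. Such a matrix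
acts on the coloured modules, its entry multiplying `F (a i ≤ a j)`. This action is additive and,
because `F` is a functor, respects composition (`realize_comp`). Hence it suffices to invert `phi`
up to homotopy over the integers, with all maps and homotopies upper.

This is done by acyclic models (`liftMap`, `liftHomotopy`). An upper map may send a basis element
labelled `z` only into the part of the target above `z`. If that part is contractible for every `z ≠
⊤`, then a map given in degree `0` extends to an upper chain map, and an upper chain map that
vanishes in degree `0` is null-homotopic by an upper homotopy. Labels in positive degree are never
`⊤`, so contractions are needed only for `z ≠ ⊤`.

They exist for both complexes. The sequences above `z` form a cone with apex `z`
(`chainContraction`). The elements above `z` form a cube of positive dimension, contracted by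
deleting an atom `b` not below `z` (`cubeContraction`). In degree `0` both groups are copies of `ℤ`
and `phi` is an isomorphism. Its inverse extends to an upper chain map `g`, and `g ∘ phi - id` and
`phi ∘ g - id` vanish in degree `0`, hence are null-homotopic. -/

namespace ColouredPoset

noncomputable section

/-! ### Integral chains with labels in a poset, and upper maps -/

section Upper

variable {B : Type u} [PartialOrder B] {I J L : Type u}

/-- The integral chains on a family of elements of a poset, supported on the elements above `z`. -/
def above (a : I → B) (z : B) : Submodule ℤ (I →₀ ℤ) := Finsupp.supported ℤ ℤ {i | z ≤ a i}

theorem single_mem_above {a : I → B} {z : B} {i : I} (h : z ≤ a i) (n : ℤ) :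
    Finsupp.single i n ∈ above a z :=
  Finsupp.single_mem_supported ℤ n h

theorem above_anti (a : I → B) {z z' : B} (h : z ≤ z') : above a z' ≤ above a z :=
  Finsupp.supported_mono fun _ hi => h.trans hi

theorem above_induction {a : I → B} {z : B} {p : (I →₀ ℤ) → Prop}
    (single : ∀ i, z ≤ a i → p (Finsupp.single i 1)) (zero : p 0)
    (add : ∀ x y, p x → p y → p (x + y)) (smul : ∀ (n : ℤ) x, p x → p (n • x))
    {c : I →₀ ℤ} (hc : c ∈ above a z) : p c := by
  rw [above, Finsupp.supported_eq_span_single] at hc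
  induction hc using Submodule.span_induction with
  | mem x hx =>
    obtain ⟨i, hi, rfl⟩ := hx
    exact single i hi
  | zero => exact zero
  | add x y _ _ hx hy => exact add x y hx hy
  | smul n x _ hx => exact smul n x hx

theorem map_eq_of_eq_on_above {a : I → B} {z : B} {N : Type*} [AddCommGroup N]
    (f g : (I →₀ ℤ) →ₗ[ℤ] N)
    (h : ∀ i, z ≤ a i → f (Finsupp.single i 1) = g (Finsupp.single i 1))
    {c : I →₀ ℤ} (hc : c ∈ above a z) : f c = g c :=
  above_induction (p := fun c => f c = g c) h (by simp)
    (fun x y hx hy => by rw [map_add, map_add, hx, hy])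
    (fun n x hx => by rw [map_smul, map_smul, hx]) hc

/-- A map of integral chains is upper if it never moves a basis element down in the poset. -/
def IsUpper (a : I → B) (b : J → B) (T : (I →₀ ℤ) →ₗ[ℤ] (J →₀ ℤ)) : Prop :=
  ∀ i, T (Finsupp.single i 1) ∈ above b (a i)

variable {a : I → B} {b : J → B} {c : L → B}

theorem IsUpper.map_mem {T : (I →₀ ℤ) →ₗ[ℤ] (J →₀ ℤ)} (hT : IsUpper a b T) {z : B}
    {x : I →₀ ℤ} (hx : x ∈ above a z) : T x ∈ above b z :=
  above_induction (p := fun x => T x ∈ above b z) (fun i hi => above_anti b hi (hT i))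
    (by simp) (fun x y hx hy => by rw [map_add]; exact add_mem hx hy)
    (fun n x hx => by rw [map_smul]; exact Submodule.smul_mem _ _ hx) hx

theorem IsUpper.comp {T : (I →₀ ℤ) →ₗ[ℤ] (J →₀ ℤ)} {S : (J →₀ ℤ) →ₗ[ℤ] (L →₀ ℤ)}
    (hS : IsUpper b c S) (hT : IsUpper a b T) : IsUpper a c (S ∘ₗ T) :=
  fun i => hS.map_mem (hT i)

theorem IsUpper.sub {T S : (I →₀ ℤ) →ₗ[ℤ] (J →₀ ℤ)}
    (hT : IsUpper a b T) (hS : IsUpper a b S) : IsUpper a b (T - S) :=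
  fun i => sub_mem (hT i) (hS i)

theorem IsUpper.zero : IsUpper a b 0 := fun _ => zero_mem _

theorem IsUpper.id : IsUpper a a LinearMap.id := fun _ => single_mem_above le_rfl 1

end Upper

/-! ### From upper integral maps to maps of coloured modules -/

section Realize

variable {R : Type w} [CommRing R] {B : Type u} [PartialOrder B] (F : B ⥤ ModuleCat.{v} R)
  {I J L : Type u} [DecidableEq I] [DecidableEq J] [DecidableEq L]

open Classical in
/-- An integral chain `c` induces the map `l ↦ ∑ c i • F (z ≤ a i) l`, where the terms with
`¬ z ≤ a i` are omitted. -/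
def realizeChain (a : I → B) (z : B) :
    (I →₀ ℤ) →ₗ[ℤ] (F.obj z →ₗ[R] ⨁ i, F.obj (a i)) :=
  Finsupp.linearCombination ℤ fun i => if h : z ≤ a i then term F a i h else 0

theorem realizeChain_single (a : I → B) {z : B} {i : I} (h : z ≤ a i) :
    realizeChain F a z (Finsupp.single i 1) = term F a i h := by
  simp [realizeChain, h]

/-- The map of direct sums of modules induced by a map of integral chains. -/
def realize (a : I → B) (b : J → B) (T : (I →₀ ℤ) →ₗ[ℤ] (J →₀ ℤ)) :
    (⨁ i, F.obj (a i)) →ₗ[R] ⨁ j, F.obj (b j) :=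
  DirectSum.toModule R I _ fun i => realizeChain F b (a i) (T (Finsupp.single i 1))

/-- On basis elements this is `F (p ≤ q ≤ b j) = F (p ≤ q ≤ b j)` split in two. Support above `q` is
essential: a term above `p` but not above `q` would be omitted on the left only. -/
theorem realizeChain_comp_map (b : J → B) {p q : B} (h : p ≤ q) {c : J →₀ ℤ}
    (hc : c ∈ above b q) :
    realizeChain F b q c ∘ₗ (F.map (homOfLE h)).hom = realizeChain F b p c := by
  refine above_induction
    (p := fun c => realizeChain F b q c ∘ₗ (F.map (homOfLE h)).hom = realizeChain F b p c)
    (fun j hj => ?_) (by simp) (fun x y hx hy => ?_) (fun n x hx => ?_) hc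
  · rw [realizeChain_single F b hj, realizeChain_single F b (h.trans hj)]
    ext1 l
    exact term_map F b j hj h l
  · rw [map_add, map_add, LinearMap.add_comp, hx, hy]
  · rw [map_smul, map_smul, LinearMap.smul_comp, hx]

variable {a : I → B} {b : J → B} {c : L → B}

theorem realize_comp_realizeChain {T : (I →₀ ℤ) →ₗ[ℤ] (J →₀ ℤ)} (hT : IsUpper a b T) {z : B}
    {x : I →₀ ℤ} (hx : x ∈ above a z) :
    realize F a b T ∘ₗ realizeChain F a z x = realizeChain F b z (T x) := by
  refine above_induction
    (p := fun x => realize F a b T ∘ₗ realizeChain F a z x = realizeChain F b z (T x))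
    (fun i hi => ?_) (by simp) (fun x y hx hy => ?_) (fun n x hx => ?_) hx
  · rw [realizeChain_single F a hi, ← realizeChain_comp_map F b hi (hT i)]
    ext1 l
    exact toModule_term F a i hi (fun i => realizeChain F b (a i) (T (Finsupp.single i 1))) l
  · rw [map_add, map_add, map_add, LinearMap.comp_add, hx, hy]
  · rw [map_smul, map_smul, map_smul, LinearMap.comp_smul, hx]

/-- Upperness ensures that no term of the product matrix is omitted, and functoriality of `F`
composes the structure maps along `a i ≤ b j ≤ c l`. This transfers every integral identity to the
coloured complexes. -/
theorem realize_comp {T : (I →₀ ℤ) →ₗ[ℤ] (J →₀ ℤ)} {S : (J →₀ ℤ) →ₗ[ℤ] (L →₀ ℤ)}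
    (hS : IsUpper b c S) (hT : IsUpper a b T) :
    realize F a c (S ∘ₗ T) = realize F b c S ∘ₗ realize F a b T := by
  apply DirectSum.linearMap_ext
  intro i
  ext1 l
  have h := LinearMap.congr_fun (realize_comp_realizeChain F hS (hT i)) l
  simpa [realize] using h.symm

theorem term_refl (a : I → B) (i : I) :
    term F a i le_rfl = DirectSum.lof R I (fun i => F.obj (a i)) i := by
  ext1 l
  simp [term]

theorem realize_id (a : I → B) : realize F a a LinearMap.id = LinearMap.id := by
  apply DirectSum.linearMap_ext
  intro i
  ext1 l
  simp only [realize, LinearMap.comp_apply, DirectSum.toModule_lof, LinearMap.id_apply]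
  rw [realizeChain_single F a le_rfl, term_refl]

theorem realize_add (T S : (I →₀ ℤ) →ₗ[ℤ] (J →₀ ℤ)) :
    realize F a b (T + S) = realize F a b T + realize F a b S := by
  apply DirectSum.linearMap_ext
  intro i
  ext1 l
  simp [realize]

theorem realize_sub (T S : (I →₀ ℤ) →ₗ[ℤ] (J →₀ ℤ)) :
    realize F a b (T - S) = realize F a b T - realize F a b S := by
  apply DirectSum.linearMap_ext
  intro i
  ext1 l
  simp [realize]

theorem realize_zero : realize F a b 0 = 0 := by
  apply DirectSum.linearMap_ext
  intro i
  ext1 l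
  simp [realize]

end Realize

/-! ### Recovering an integral matrix from the constant colouring -/

section Constant

variable {B : Type u} [PartialOrder B] {I J : Type u} [DecidableEq I] [DecidableEq J]

variable (B) in
/-- The colouring of a poset with constant value `ℚ`. -/
def constRat : B ⥤ ModuleCat.{0} ℚ := (Functor.const B).obj (ModuleCat.of ℚ ℚ)

/-- The element `1` of a value of the constant colouring. -/
def constOne (z : B) : (constRat B).obj z := (1 : ℚ)

/-- The values of the constant colouring are copies of `ℚ`. -/
def constVal (z : B) : (constRat B).obj z →ₗ[ℚ] ℚ := (LinearMap.id : ℚ →ₗ[ℚ] ℚ)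

theorem constVal_map_one {y z : B} (h : y ⟶ z) :
    constVal z (((constRat B).map h).hom (constOne y)) = 1 := rfl

/-- The coefficient at `j` of an element of the direct sum of copies of `ℚ`. -/
def constCoeff (b : J → B) (j : J) : (⨁ j, (constRat B).obj (b j)) →ₗ[ℚ] ℚ :=
  DirectSum.toModule ℚ J ℚ fun i => if i = j then constVal (b i) else 0

theorem constCoeff_realizeChain (b : J → B) {z : B} {c : J →₀ ℤ} (hc : c ∈ above b z) (j : J) :
    constCoeff b j (realizeChain (constRat B) b z c (constOne z)) = (c j : ℚ) := by
  refine above_induction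
    (p := fun c => constCoeff b j (realizeChain (constRat B) b z c (constOne z)) = (c j : ℚ))
    (fun i hi => ?_) ?_ (fun x y hx hy => ?_) (fun n x hx => ?_) hc
  · rw [realizeChain_single _ b hi, constCoeff, toModule_term, Finsupp.single_apply,
      apply_ite (Int.cast : ℤ → ℚ), Int.cast_one, Int.cast_zero]
    split_ifs with h
    · exact constVal_map_one _
    · rfl
  · rw [map_zero, LinearMap.zero_apply, map_zero, Finsupp.zero_apply, Int.cast_zero]
  · rw [map_add, LinearMap.add_apply, map_add, hx, hy, Finsupp.add_apply, Int.cast_add]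
  · rw [map_smul, LinearMap.smul_apply, map_zsmul, hx, Finsupp.smul_apply, zsmul_eq_mul,
      smul_eq_mul, Int.cast_mul]

/-- With all structure maps equal to the identity of `ℚ`, the matrix entries are read off as
coefficients of the image of `1`, and `ℤ → ℚ` is injective. Thus `d ∘ d = 0` and the commutation of
`phi` with `d`, known for every colouring, descend to the integers. -/
theorem realize_constRat_injective {a : I → B} {b : J → B} {T S : (I →₀ ℤ) →ₗ[ℤ] (J →₀ ℤ)}
    (hT : IsUpper a b T) (hS : IsUpper a b S)
    (h : realize (constRat B) a b T = realize (constRat B) a b S) : T = S := by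
  apply Finsupp.lhom_ext'
  intro i
  ext j
  have h1 := congrArg (constCoeff b j) (LinearMap.congr_fun h
    (DirectSum.lof ℚ I (fun i => (constRat B).obj (a i)) i (constOne (a i))))
  simp only [realize, DirectSum.toModule_lof] at h1
  rw [constCoeff_realizeChain b (hT i), constCoeff_realizeChain b (hS i)] at h1
  exact Int.cast_injective h1

end Constant

end

end ColouredPoset
namespace ColouredPoset

noncomputable section

/-! ### Acyclic models: lifting maps and homotopies through contractions -/

section Comparison

/-- A chain complex of free abelian groups whose basis elements are labelled by elements of a poset,
such that the differential does not move basis elements down. -/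
structure UpperComplex (B : Type u) [PartialOrder B] where
  idx : ℕ → Type u
  decEq : ∀ k, DecidableEq (idx k)
  elt : ∀ k, idx k → B
  d : ∀ k, (idx (k + 1) →₀ ℤ) →ₗ[ℤ] (idx k →₀ ℤ)
  d_upper : ∀ k, IsUpper (elt (k + 1)) (elt k) (d k)
  d_d : ∀ k c, d k (d (k + 1) c) = 0

attribute [instance] UpperComplex.decEq

variable {B : Type u} [PartialOrder B]

/-- A contraction of the part of an `UpperComplex` that lies above `z`. -/
structure UpperComplex.Contraction (X : UpperComplex B) (z : B) where
  s : ∀ k, (X.idx k →₀ ℤ) →ₗ[ℤ] (X.idx (k + 1) →₀ ℤ)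
  s_mem : ∀ k c, c ∈ above (X.elt k) z → s k c ∈ above (X.elt (k + 1)) z
  d_s_zero : ∀ c, c ∈ above (X.elt 0) z → X.d 0 (s 0 c) = c
  d_s_succ : ∀ k c, c ∈ above (X.elt (k + 1)) z → X.d (k + 1) (s (k + 1) c) + s k (X.d k c) = c

variable {X Y : UpperComplex B} {p : B → Prop}
  (S : ∀ z, p z → Y.Contraction z) (hX : ∀ k i, p (X.elt (k + 1) i))

/-- The extension of a map in degree `0` to a chain map, by means of contractions. -/
def liftMap (f : (X.idx 0 →₀ ℤ) →ₗ[ℤ] (Y.idx 0 →₀ ℤ)) :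
    ∀ k, (X.idx k →₀ ℤ) →ₗ[ℤ] (Y.idx k →₀ ℤ)
  | 0 => f
  | k + 1 => Finsupp.linearCombination ℤ fun i =>
      (S (X.elt (k + 1) i) (hX k i)).s k (liftMap f k (X.d k (Finsupp.single i 1)))

theorem liftMap_single (f : (X.idx 0 →₀ ℤ) →ₗ[ℤ] (Y.idx 0 →₀ ℤ)) (k : ℕ) (i : X.idx (k + 1)) :
    liftMap S hX f (k + 1) (Finsupp.single i 1) =
      (S (X.elt (k + 1) i) (hX k i)).s k (liftMap S hX f k (X.d k (Finsupp.single i 1))) := by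
  simp [liftMap]

/-- The value on a basis element is obtained with the contraction at its own label, which stays
above that label. -/
theorem liftMap_upper {f : (X.idx 0 →₀ ℤ) →ₗ[ℤ] (Y.idx 0 →₀ ℤ)}
    (hf : IsUpper (X.elt 0) (Y.elt 0) f) (k : ℕ) :
    IsUpper (X.elt k) (Y.elt k) (liftMap S hX f k) := by
  induction k with
  | zero => exact hf
  | succ k ih =>
    intro i
    rw [liftMap_single]
    exact (S _ (hX k i)).s_mem k _ (ih.map_mem (X.d_upper k i))

theorem d_liftMap {f : (X.idx 0 →₀ ℤ) →ₗ[ℤ] (Y.idx 0 →₀ ℤ)}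
    (hf : IsUpper (X.elt 0) (Y.elt 0) f) (k : ℕ) :
    Y.d k ∘ₗ liftMap S hX f (k + 1) = liftMap S hX f k ∘ₗ X.d k := by
  induction k with
  | zero =>
    apply Finsupp.lhom_ext'
    intro i
    ext1
    simp only [LinearMap.comp_apply, Finsupp.lsingle_apply]
    rw [liftMap_single, (S _ (hX 0 i)).d_s_zero]
    exact (liftMap_upper S hX hf 0).map_mem (X.d_upper 0 i)
  | succ k ih =>
    apply Finsupp.lhom_ext'
    intro i
    ext1
    simp only [LinearMap.comp_apply, Finsupp.lsingle_apply]
    have h := (S _ (hX (k + 1) i)).d_s_succ k _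
      ((liftMap_upper S hX hf (k + 1)).map_mem (X.d_upper (k + 1) i))
    have h1 := LinearMap.congr_fun ih (X.d (k + 1) (Finsupp.single i 1))
    simp only [LinearMap.comp_apply] at h1
    -- The lift of a boundary is a cycle, by the induction hypothesis and `d ∘ d = 0`; on cycles the
    -- contraction identity reduces to `d (s c) = c`.
    rw [h1, X.d_d, map_zero, map_zero, add_zero] at h
    rw [liftMap_single, h]

/-- The null homotopy of a chain map that vanishes in degree `0`, by means of contractions. -/
def liftHomotopy (f : ∀ k, (X.idx k →₀ ℤ) →ₗ[ℤ] (Y.idx k →₀ ℤ)) :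
    ∀ k, (X.idx k →₀ ℤ) →ₗ[ℤ] (Y.idx (k + 1) →₀ ℤ)
  | 0 => 0
  | k + 1 => Finsupp.linearCombination ℤ fun i =>
      (S (X.elt (k + 1) i) (hX k i)).s (k + 1)
        (f (k + 1) (Finsupp.single i 1) - liftHomotopy f k (X.d k (Finsupp.single i 1)))

variable {f : ∀ k, (X.idx k →₀ ℤ) →ₗ[ℤ] (Y.idx k →₀ ℤ)}

theorem liftHomotopy_single (k : ℕ) (i : X.idx (k + 1)) :
    liftHomotopy S hX f (k + 1) (Finsupp.single i 1) =
      (S (X.elt (k + 1) i) (hX k i)).s (k + 1) (f (k + 1) (Finsupp.single i 1) -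
        liftHomotopy S hX f k (X.d k (Finsupp.single i 1))) := by
  simp [liftHomotopy]

theorem liftHomotopy_upper (hf : ∀ k, IsUpper (X.elt k) (Y.elt k) (f k)) (k : ℕ) :
    IsUpper (X.elt k) (Y.elt (k + 1)) (liftHomotopy S hX f k) := by
  induction k with
  | zero => exact IsUpper.zero
  | succ k ih =>
    intro i
    rw [liftHomotopy_single]
    exact (S _ (hX k i)).s_mem (k + 1) _ (sub_mem (hf (k + 1) i) (ih.map_mem (X.d_upper k i)))

/-- The element to which the contraction is applied, `f i - h (d i)`, is a cycle: by `f 0 = 0` at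
the start, and afterwards by the homotopy identity one degree lower. Contracting it therefore
produces a chain with that boundary. -/
theorem d_liftHomotopy (hf : ∀ k, IsUpper (X.elt k) (Y.elt k) (f k))
    (hd : ∀ k, Y.d k ∘ₗ f (k + 1) = f k ∘ₗ X.d k) (h0 : f 0 = 0) (k : ℕ) :
    Y.d (k + 1) ∘ₗ liftHomotopy S hX f (k + 1) + liftHomotopy S hX f k ∘ₗ X.d k = f (k + 1) := by
  have key : ∀ k i, Y.d k (f (k + 1) (Finsupp.single i 1) -
      liftHomotopy S hX f k (X.d k (Finsupp.single i 1))) = 0 →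
      Y.d (k + 1) (liftHomotopy S hX f (k + 1) (Finsupp.single i 1)) +
        liftHomotopy S hX f k (X.d k (Finsupp.single i 1)) = f (k + 1) (Finsupp.single i 1) := by
    intro k i hk
    have h := (S _ (hX k i)).d_s_succ k _ (sub_mem (hf (k + 1) i)
      ((liftHomotopy_upper S hX hf k).map_mem (X.d_upper k i)))
    rw [hk, map_zero, add_zero] at h
    rw [liftHomotopy_single, h, sub_add_cancel]
  induction k with
  | zero =>
    apply Finsupp.lhom_ext'
    intro i
    ext1
    refine key 0 i ?_
    have h1 := LinearMap.congr_fun (hd 0) (Finsupp.single i 1)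
    simp only [LinearMap.comp_apply] at h1
    rw [map_sub, h1, h0]
    simp [liftHomotopy]
  | succ k ih =>
    apply Finsupp.lhom_ext'
    intro i
    ext1
    refine key (k + 1) i ?_
    have h1 := LinearMap.congr_fun (hd (k + 1)) (Finsupp.single i 1)
    have h2 := LinearMap.congr_fun ih (X.d (k + 1) (Finsupp.single i 1))
    simp only [LinearMap.comp_apply, LinearMap.add_apply] at h1 h2
    rw [X.d_d, map_zero, add_zero] at h2
    rw [map_sub, h1, h2, sub_self]

end Comparison

/-! ### Transfer of homotopy equivalences to coloured complexes -/

section Transfer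

variable {R : Type w} [CommRing R] {B : Type u} [PartialOrder B] (F : B ⥤ ModuleCat.{v} R)

/-- The degree `k` part of the complex of modules defined by an `UpperComplex` and a colouring. -/
abbrev UpperComplex.realizeModule (X : UpperComplex B) (k : ℕ) : ModuleCat.{max u v} R :=
  ModuleCat.of R (⨁ i : X.idx k, F.obj (X.elt k i))

/-- The differential of the complex of modules defined by an `UpperComplex` and a colouring. -/
def UpperComplex.realizeDifferential (X : UpperComplex B) (k : ℕ) :
    X.realizeModule F (k + 1) ⟶ X.realizeModule F k :=
  ModuleCat.ofHom (realize F (X.elt (k + 1)) (X.elt k) (X.d k))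

theorem UpperComplex.realizeDifferential_comp (X : UpperComplex B) (k : ℕ) :
    X.realizeDifferential F (k + 1) ≫ X.realizeDifferential F k = 0 := by
  rw [realizeDifferential, realizeDifferential, ← ModuleCat.ofHom_comp,
    ← realize_comp F (X.d_upper k) (X.d_upper (k + 1)),
    show X.d k ∘ₗ X.d (k + 1) = 0 from LinearMap.ext (X.d_d k), realize_zero]
  rfl

/-- The complex of modules defined by an `UpperComplex` and a colouring. -/
def UpperComplex.realizeCx (X : UpperComplex B) : ChainComplex (ModuleCat.{max u v} R) ℕ :=
  ChainComplex.of (X.realizeModule F) (X.realizeDifferential F) (X.realizeDifferential_comp F)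

theorem UpperComplex.realizeCx_d (X : UpperComplex B) (k : ℕ) :
    (X.realizeCx F).d (k + 1) k =
      ModuleCat.ofHom (realize F (X.elt (k + 1)) (X.elt k) (X.d k)) :=
  ChainComplex.of_d _ _ _

variable {X Y : UpperComplex B}

/-- The chain map of complexes of modules induced by a chain map of integral complexes. -/
def realizeHom (f : ∀ k, (X.idx k →₀ ℤ) →ₗ[ℤ] (Y.idx k →₀ ℤ))
    (hf : ∀ k, IsUpper (X.elt k) (Y.elt k) (f k))
    (hd : ∀ k, Y.d k ∘ₗ f (k + 1) = f k ∘ₗ X.d k) : X.realizeCx F ⟶ Y.realizeCx F :=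
  ChainComplex.ofHom (fun k => ModuleCat.ofHom (realize F (X.elt k) (Y.elt k) (f k))) fun k => by
    rw [UpperComplex.realizeCx_d, UpperComplex.realizeCx_d]
    refine (ModuleCat.ofHom_comp _ _).symm.trans (Eq.trans ?_ (ModuleCat.ofHom_comp _ _))
    rw [← realize_comp F (Y.d_upper k) (hf (k + 1)), ← realize_comp F (hf k) (X.d_upper k), hd]

theorem realizeHom_f (f : ∀ k, (X.idx k →₀ ℤ) →ₗ[ℤ] (Y.idx k →₀ ℤ))
    (hf : ∀ k, IsUpper (X.elt k) (Y.elt k) (f k))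
    (hd : ∀ k, Y.d k ∘ₗ f (k + 1) = f k ∘ₗ X.d k) (k : ℕ) :
    (realizeHom F f hf hd).f k = ModuleCat.ofHom (realize F (X.elt k) (Y.elt k) (f k)) := rfl

theorem nonempty_homotopy_zero {p : B → Prop} (S : ∀ z, p z → Y.Contraction z)
    (hX : ∀ k i, p (X.elt (k + 1) i)) (f : ∀ k, (X.idx k →₀ ℤ) →ₗ[ℤ] (Y.idx k →₀ ℤ))
    (hf : ∀ k, IsUpper (X.elt k) (Y.elt k) (f k))
    (hd : ∀ k, Y.d k ∘ₗ f (k + 1) = f k ∘ₗ X.d k) (h0 : f 0 = 0) :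
    Nonempty (Homotopy (realizeHom F f hf hd) 0) := by
  let H : ∀ i j, (ComplexShape.down ℕ).Rel j i → ((X.realizeCx F).X i ⟶ (Y.realizeCx F).X j) :=
    fun i j hij => by
      obtain rfl : i + 1 = j := hij
      exact ModuleCat.ofHom (realize F (X.elt i) (Y.elt (i + 1)) (liftHomotopy S hX f i))
  have hH : realizeHom F f hf hd = Homotopy.nullHomotopicMap' H := by
    ext1 k
    cases k with
    | zero =>
      -- No differential leaves degree `0`, so only `d ∘ h` remains there, and it vanishes since the
      -- homotopy starts with `0`.
      rw [Homotopy.nullHomotopicMap'_f_of_not_rel_left (k₁ := 1) (k₀ := 0) rfl (by simp),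
        UpperComplex.realizeCx_d, realizeHom_f, h0]
      refine Eq.trans ?_ (ModuleCat.ofHom_comp _ _)
      rw [← realize_comp F (Y.d_upper 0) (liftHomotopy_upper S hX hf 0)]
      simp only [liftHomotopy, LinearMap.comp_zero]
      rfl
    | succ k =>
      rw [Homotopy.nullHomotopicMap'_f (k₂ := k + 2) (k₁ := k + 1) (k₀ := k) rfl rfl,
        UpperComplex.realizeCx_d, UpperComplex.realizeCx_d, realizeHom_f]
      refine Eq.trans (congrArg (fun T => ModuleCat.ofHom (realize F _ _ T))
        (d_liftHomotopy S hX hf hd h0 k).symm)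
        (Eq.trans ?_ (congrArg₂ (· + ·) (ModuleCat.ofHom_comp _ _) (ModuleCat.ofHom_comp _ _)))
      rw [← realize_comp F (liftHomotopy_upper S hX hf k) (X.d_upper k),
        ← realize_comp F (Y.d_upper (k + 1)) (liftHomotopy_upper S hX hf (k + 1)),
        realize_add]
      exact add_comm (ModuleCat.ofHom _) (ModuleCat.ofHom _)
  rw [hH]
  exact ⟨Homotopy.nullHomotopy' H⟩

/-- The degree `0` inverse `g₀` extends to a chain map `g` through the contractions of `X`. The
contractions of `X` and of `Y` then make `g ∘ f - id` and `f ∘ g - id` null-homotopic, since both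
vanish in degree `0`. -/
theorem exists_homotopyEquiv_realizeHom {p : B → Prop}
    (SX : ∀ z, p z → X.Contraction z) (SY : ∀ z, p z → Y.Contraction z)
    (hX : ∀ k i, p (X.elt (k + 1) i)) (hY : ∀ k i, p (Y.elt (k + 1) i))
    (f : ∀ k, (X.idx k →₀ ℤ) →ₗ[ℤ] (Y.idx k →₀ ℤ))
    (hf : ∀ k, IsUpper (X.elt k) (Y.elt k) (f k))
    (hd : ∀ k, Y.d k ∘ₗ f (k + 1) = f k ∘ₗ X.d k)
    (g₀ : (Y.idx 0 →₀ ℤ) →ₗ[ℤ] (X.idx 0 →₀ ℤ)) (hg₀ : IsUpper (Y.elt 0) (X.elt 0) g₀)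
    (hfg : f 0 ∘ₗ g₀ = LinearMap.id) (hgf : g₀ ∘ₗ f 0 = LinearMap.id) :
    ∃ h : HomotopyEquiv (X.realizeCx F) (Y.realizeCx F), h.hom = realizeHom F f hf hd := by
  let g := liftMap SX hY g₀
  have hg : ∀ k, IsUpper (Y.elt k) (X.elt k) (g k) := liftMap_upper SX hY hg₀
  have hgd : ∀ k, X.d k ∘ₗ g (k + 1) = g k ∘ₗ Y.d k := d_liftMap SX hY hg₀
  obtain ⟨h1⟩ := nonempty_homotopy_zero F SX hX (fun k => g k ∘ₗ f k - LinearMap.id)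
    (fun k => ((hg k).comp (hf k)).sub IsUpper.id)
    (fun k => by
      rw [LinearMap.comp_sub, LinearMap.sub_comp, ← LinearMap.comp_assoc, hgd,
        LinearMap.comp_assoc, hd]
      rfl)
    (sub_eq_zero.2 hgf)
  obtain ⟨h2⟩ := nonempty_homotopy_zero F SY hY (fun k => f k ∘ₗ g k - LinearMap.id)
    (fun k => ((hf k).comp (hg k)).sub IsUpper.id)
    (fun k => by
      rw [LinearMap.comp_sub, LinearMap.sub_comp, ← LinearMap.comp_assoc, hd,
        LinearMap.comp_assoc, hgd]
      rfl)
    (sub_eq_zero.2 hfg)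
  refine ⟨⟨realizeHom F f hf hd, realizeHom F g hg hgd,
    Homotopy.equivSubZero.symm ((Homotopy.ofEq ?_).trans h1),
    Homotopy.equivSubZero.symm ((Homotopy.ofEq ?_).trans h2)⟩, rfl⟩
  · ext1 k
    rw [realizeHom_f, realize_sub, realize_comp F (hg k) (hf k), realize_id]
    rfl
  · ext1 k
    rw [realizeHom_f, realize_sub, realize_comp F (hf k) (hg k), realize_id]
    rfl

end Transfer

end

end ColouredPoset
namespace ColouredPoset

noncomputable section

/-! ### The integral complex of ordered sequences and its cone contraction -/

section ChainInt

variable {P : Type u} [PartialOrder P] [OrderTop P]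

/-- The differential of the integral chains on the ordered sequences in `P ∖ 1`. -/
def chainInt (k : ℕ) : (OrdSeq P (k + 1) →₀ ℤ) →ₗ[ℤ] (OrdSeq P k →₀ ℤ) :=
  Finsupp.linearCombination ℤ fun x =>
    ∑ i : Fin (k + 1), ((-1 : ℤ) ^ (i : ℕ)) • Finsupp.single (x.face i) 1

theorem chainInt_single (k : ℕ) (x : OrdSeq P (k + 1)) :
    chainInt k (Finsupp.single x 1) =
      ∑ i : Fin (k + 1), ((-1 : ℤ) ^ (i : ℕ)) • Finsupp.single (x.face i) 1 := by
  rw [chainInt, Finsupp.linearCombination_single, one_smul]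

theorem chainInt_upper (k : ℕ) :
    IsUpper (OrdSeq.first (P := P) (k := k + 1)) OrdSeq.first (chainInt k) := fun x => by
  rw [chainInt_single]
  exact sum_mem fun i _ => Submodule.smul_mem _ _ (single_mem_above (x.first_le_face i) 1)

theorem chainDifferential_eq {R : Type w} [CommRing R] (F : P ⥤ ModuleCat.{v} R) (k : ℕ) :
    chainDifferential F k = ModuleCat.ofHom (realize F OrdSeq.first OrdSeq.first (chainInt k)) := by
  rw [chainDifferential, realize]
  congr 2
  funext x
  rw [chainInt_single, map_sum]
  refine Finset.sum_congr rfl fun i _ => ?_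
  rw [map_smul, realizeChain_single F _ (x.first_le_face i)]

theorem chainInt_comp (k : ℕ) : chainInt (P := P) k ∘ₗ chainInt (k + 1) = 0 := by
  apply realize_constRat_injective ((chainInt_upper k).comp (chainInt_upper (k + 1))) IsUpper.zero
  rw [realize_comp _ (chainInt_upper k) (chainInt_upper (k + 1)), realize_zero]
  have h := chainDifferential_comp (constRat P) k
  rw [chainDifferential_eq, chainDifferential_eq, ← ModuleCat.ofHom_comp] at h
  exact congrArg ModuleCat.Hom.hom h

variable (P) in
/-- The integral chains on the ordered sequences in `P ∖ 1`. -/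
def chainUpper : UpperComplex P where
  idx := OrdSeq P
  decEq := fun _ => inferInstance
  elt := fun _ => OrdSeq.first
  d := chainInt
  d_upper := chainInt_upper
  d_d := fun k c => LinearMap.congr_fun (chainInt_comp k) c

/-- Put a smaller element in front of an ordered sequence. -/
def OrdSeq.cons {k : ℕ} (z : P) (x : OrdSeq P k) (h : z < x.first) : OrdSeq P (k + 1) where
  seq := Fin.cons z x.seq
  strictMono := Fin.strictMono_iff_lt_succ.2 fun i => by
    refine Fin.cases ?_ (fun j => ?_) i
    · exact h
    · rw [← Fin.succ_castSucc, Fin.cons_succ, Fin.cons_succ]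
      exact x.strictMono (Fin.castSucc_lt_succ)
  last_eq := by
    rw [← Fin.succ_last, Fin.cons_succ]
    exact x.last_eq

theorem OrdSeq.first_cons {k : ℕ} (z : P) (x : OrdSeq P k) (h : z < x.first) :
    (x.cons z h).first = z := rfl

theorem OrdSeq.face_zero_cons {k : ℕ} (z : P) (x : OrdSeq P k) (h : z < x.first) :
    (x.cons z h).face 0 = x :=
  OrdSeq.ext (funext fun i => OrdSeq.succ_face_zero (x.cons z h) i)

theorem OrdSeq.face_succ_cons {k : ℕ} (z : P) (x : OrdSeq P (k + 1)) (h : z < x.first)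
    (i : Fin (k + 1)) :
    (x.cons z h).face i.succ = (x.face i).cons z (h.trans_le (x.first_le_face i)) := by
  apply OrdSeq.ext
  funext j
  refine Fin.cases ?_ (fun j => ?_) j
  · rfl
  · simp [OrdSeq.face, OrdSeq.cons]
    rfl

theorem OrdSeq.first_lt_face_zero {k : ℕ} (x : OrdSeq P (k + 1)) : x.first < (x.face 0).first :=
  x.strictMono (Fin.castSucc_lt_succ (i := (0 : Fin (k + 1))))

theorem OrdSeq.first_face_succ {k : ℕ} (x : OrdSeq P (k + 2)) (i : Fin (k + 1)) :
    (x.face i.succ).first = x.first := by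
  simp [OrdSeq.face, OrdSeq.first]

theorem OrdSeq.cons_face_zero {k : ℕ} (x : OrdSeq P (k + 1)) {z : P} (h : z = x.first)
    (h' : z < (x.face 0).first) : (x.face 0).cons z h' = x := by
  subst h
  apply OrdSeq.ext
  funext j
  refine Fin.cases rfl (fun j => ?_) j
  exact OrdSeq.succ_face_zero x j

theorem OrdSeq.first_ne_top {k : ℕ} (x : OrdSeq P (k + 1)) : x.first ≠ ⊤ :=
  (x.first_lt_face_zero.trans_le le_top).ne

theorem OrdSeq.first_eq_top (x : OrdSeq P 0) : x.first = ⊤ := x.last_eq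

open Classical in
/-- Put `z` in front of the ordered sequences that start above `z`. -/
def chainCone (z : P) (k : ℕ) : (OrdSeq P k →₀ ℤ) →ₗ[ℤ] (OrdSeq P (k + 1) →₀ ℤ) :=
  Finsupp.linearCombination ℤ fun x =>
    if h : z < x.first then Finsupp.single (x.cons z h) 1 else 0

theorem chainCone_of_lt {z : P} {k : ℕ} {x : OrdSeq P k} (h : z < x.first) :
    chainCone z k (Finsupp.single x 1) = Finsupp.single (x.cons z h) 1 := by
  rw [chainCone, Finsupp.linearCombination_single, one_smul, dif_pos h]

theorem chainCone_of_eq {z : P} {k : ℕ} {x : OrdSeq P k} (h : z = x.first) :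
    chainCone z k (Finsupp.single x 1) = 0 := by
  rw [chainCone, Finsupp.linearCombination_single, one_smul, dif_neg h.not_lt]

/-- The only face of `z x` deletes `z`. As `x` starts with `⊤`, the hypothesis amounts to `z ≠ ⊤`.
-/
theorem chainInt_chainCone_zero {z : P} (x : OrdSeq P 0) (h : z < x.first) :
    chainInt 0 (chainCone z 0 (Finsupp.single x 1)) = Finsupp.single x 1 := by
  rw [chainCone_of_lt h, chainInt_single]
  simp [OrdSeq.face_zero_cons]

/-- If `x` starts strictly above `z`, then face `0` of `z x` is `x`, and its later faces are the
cones on the faces of `x` with opposite sign. If `x` starts with `z`, its cone is zero; so are the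
cones on its faces that keep `z`, and the cone on face `0` restores `x`. -/
theorem chainInt_chainCone_succ {z : P} {k : ℕ} (x : OrdSeq P (k + 1)) (h : z ≤ x.first) :
    chainInt (k + 1) (chainCone z (k + 1) (Finsupp.single x 1)) +
      chainCone z k (chainInt k (Finsupp.single x 1)) = Finsupp.single x 1 := by
  rcases h.lt_or_eq with h | h
  · rw [chainCone_of_lt h, chainInt_single, chainInt_single, Fin.sum_univ_succ,
      OrdSeq.face_zero_cons, map_sum, add_assoc, ← Finset.sum_add_distrib,
      Finset.sum_eq_zero, add_zero, Fin.val_zero, pow_zero, one_smul]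
    intro i _
    rw [map_smul, chainCone_of_lt (h.trans_le (x.first_le_face i)), OrdSeq.face_succ_cons,
      Fin.val_succ, pow_succ, mul_neg_one, neg_smul, neg_add_cancel]
  · have h0 : z < (x.face 0).first := h.trans_lt x.first_lt_face_zero
    rw [chainCone_of_eq h, map_zero, zero_add, chainInt_single, map_sum, Fin.sum_univ_succ,
      Finset.sum_eq_zero, add_zero, Fin.val_zero, pow_zero, one_smul, chainCone_of_lt h0,
      OrdSeq.cons_face_zero x h h0]
    intro i _
    -- A later face exists only if the sequence has a second entry before `⊤`; it then still starts
    -- with `z`.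
    cases k with
    | zero => exact i.elim0
    | succ k => rw [map_smul, chainCone_of_eq (h.trans (x.first_face_succ i).symm), smul_zero]

theorem chainCone_mem (z : P) (k : ℕ) (c : OrdSeq P k →₀ ℤ)
    (hc : c ∈ above OrdSeq.first z) : chainCone z k c ∈ above OrdSeq.first z := by
  refine above_induction (p := fun c => chainCone z k c ∈ above OrdSeq.first z)
    (fun x hx => ?_) (by simp) (fun x y hx hy => by rw [map_add]; exact add_mem hx hy)
    (fun n x hx => by rw [map_smul]; exact Submodule.smul_mem _ _ hx) hc
  rcases hx.lt_or_eq with h | h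
  · rw [chainCone_of_lt h]
    exact single_mem_above (OrdSeq.first_cons z x h).ge 1
  · rw [chainCone_of_eq h]
    exact zero_mem _

/-- The part of the integral chains above `z ≠ 1` is a cone. -/
def chainContraction (z : P) (hz : z ≠ ⊤) : (chainUpper P).Contraction z where
  s := chainCone z
  s_mem := chainCone_mem z
  d_s_zero := fun _ hc => map_eq_of_eq_on_above (chainInt 0 ∘ₗ chainCone z 0) LinearMap.id
    (fun x _ => chainInt_chainCone_zero x (x.first_eq_top ▸ lt_top_iff_ne_top.2 hz)) hc
  d_s_succ := fun k _ hc => map_eq_of_eq_on_above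
    (chainInt (k + 1) ∘ₗ chainCone z (k + 1) + chainCone z k ∘ₗ chainInt k) LinearMap.id
    (fun x hx => chainInt_chainCone_succ x hx) hc

end ChainInt

/-! ### The integral cube complex -/

section CubeInt

variable {B : Type u} [PartialOrder B] {r : ℕ} (e : B ≃o Finset (Fin r))

/-- The differential of the integral cube complex. -/
def cubeInt (k : ℕ) : (CubeIdx e (k + 1) →₀ ℤ) →ₗ[ℤ] (CubeIdx e k →₀ ℤ) :=
  Finsupp.linearCombination ℤ fun x =>
    ∑ y : Cover x, sign e x.elt y.idx.elt • Finsupp.single y.idx 1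

theorem cubeInt_single (k : ℕ) (x : CubeIdx e (k + 1)) :
    cubeInt e k (Finsupp.single x 1) =
      ∑ y : Cover x, sign e x.elt y.idx.elt • Finsupp.single y.idx 1 := by
  rw [cubeInt, Finsupp.linearCombination_single, one_smul]

theorem cubeInt_upper (k : ℕ) :
    IsUpper (CubeIdx.elt (e := e) (k := k + 1)) CubeIdx.elt (cubeInt e k) := fun x => by
  rw [cubeInt_single]
  exact sum_mem fun y _ => Submodule.smul_mem _ _ (single_mem_above y.covBy.le 1)

theorem cubeDifferential_eq {R : Type w} [CommRing R] (F : B ⥤ ModuleCat.{v} R) (k : ℕ) :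
    cubeDifferential e F k =
      ModuleCat.ofHom (realize F CubeIdx.elt CubeIdx.elt (cubeInt e k)) := by
  rw [cubeDifferential, realize]
  congr 2
  funext x
  rw [cubeInt_single, map_sum]
  refine Finset.sum_congr rfl fun y _ => ?_
  rw [map_smul, realizeChain_single F _ y.covBy.le]

theorem cubeInt_comp (k : ℕ) : cubeInt e k ∘ₗ cubeInt e (k + 1) = 0 := by
  apply realize_constRat_injective ((cubeInt_upper e k).comp (cubeInt_upper e (k + 1)))
    IsUpper.zero
  rw [realize_comp _ (cubeInt_upper e k) (cubeInt_upper e (k + 1)), realize_zero]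
  have h := cubeDifferential_comp e (constRat B) k
  rw [cubeDifferential_eq, cubeDifferential_eq, ← ModuleCat.ofHom_comp] at h
  exact congrArg ModuleCat.Hom.hom h

/-- The integral cube complex. -/
def cubeUpper : UpperComplex B where
  idx := CubeIdx e
  decEq := fun _ => inferInstance
  elt := fun _ => CubeIdx.elt
  d := cubeInt e
  d_upper := cubeInt_upper e
  d_d := fun k c => LinearMap.congr_fun (cubeInt_comp e k) c

end CubeInt

end

end ColouredPoset
namespace ColouredPoset

noncomputable section

/-! ### Contracting the cube complex by deleting an atom -/

section CubeContraction

variable {B : Type u} [PartialOrder B] {r : ℕ} (e : B ≃o Finset (Fin r))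

theorem covBy_iff_exists_insert {x y : B} : x ⋖ y ↔ ∃ a ∉ e x, insert a (e x) = e y := by
  rw [← apply_covBy_apply_iff e, Finset.covBy_iff_exists_insert]

theorem sign_mul_self {x y : B} (h : x ⋖ y) : sign e x y * sign e x y = 1 := by
  obtain ⟨a, ha, hay⟩ := (covBy_iff_exists_insert e).1 h
  rw [sign_insert e ha hay.symm, ← pow_add, ← two_mul, pow_mul, neg_one_sq, one_pow]

variable {e}

instance {k : ℕ} (x : CubeIdx e (k + 1)) : DecidableEq (Cover x) := Classical.decEq _

/-- Delete the atom `b`. -/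
def CubeIdx.delete {k : ℕ} (y : CubeIdx e k) (b : Fin r) (h : b ∈ e y.elt) : CubeIdx e (k + 1) where
  elt := e.symm ((e y.elt).erase b)
  card_add := by
    have h1 := y.card_add
    have h2 := Finset.card_erase_add_one h
    rw [OrderIso.apply_symm_apply]
    omega

theorem CubeIdx.apply_delete {k : ℕ} (y : CubeIdx e k) (b : Fin r) (h : b ∈ e y.elt) :
    e (y.delete b h).elt = (e y.elt).erase b :=
  OrderIso.apply_symm_apply _ _

theorem CubeIdx.delete_covBy {k : ℕ} (y : CubeIdx e k) (b : Fin r) (h : b ∈ e y.elt) :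
    (y.delete b h).elt ⋖ y.elt := by
  rw [covBy_iff_exists_insert e]
  exact ⟨b, by simp [apply_delete], by rw [apply_delete, Finset.insert_erase h]⟩

theorem CubeIdx.ext_apply {k : ℕ} {x y : CubeIdx e k} (h : e x.elt = e y.elt) : x = y :=
  CubeIdx.ext (e.injective h)

theorem Cover.ext_apply {k : ℕ} {x : CubeIdx e (k + 1)} {y y' : Cover x}
    (h : e y.idx.elt = e y'.idx.elt) : y = y' :=
  Cover.ext (CubeIdx.ext_apply h)

/-- `y` as a cover of `y ∖ b`. -/
def CubeIdx.deleteCover {k : ℕ} (y : CubeIdx e k) (b : Fin r) (h : b ∈ e y.elt) :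
    Cover (y.delete b h) :=
  ⟨y, y.delete_covBy b h⟩

variable (e) in
/-- Delete the atom `b` from the elements that contain it, with sign. -/
def cubeDelete (b : Fin r) (k : ℕ) : (CubeIdx e k →₀ ℤ) →ₗ[ℤ] (CubeIdx e (k + 1) →₀ ℤ) :=
  Finsupp.linearCombination ℤ fun y =>
    if h : b ∈ e y.elt then
      sign e (y.delete b h).elt y.elt • Finsupp.single (y.delete b h) 1
    else 0

theorem cubeDelete_of_mem {b : Fin r} {k : ℕ} {y : CubeIdx e k} (h : b ∈ e y.elt) :
    cubeDelete e b k (Finsupp.single y 1) =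
      sign e (y.delete b h).elt y.elt • Finsupp.single (y.delete b h) 1 := by
  rw [cubeDelete, Finsupp.linearCombination_single, one_smul, dif_pos h]

theorem cubeDelete_of_notMem {b : Fin r} {k : ℕ} {y : CubeIdx e k} (h : b ∉ e y.elt) :
    cubeDelete e b k (Finsupp.single y 1) = 0 := by
  rw [cubeDelete, Finsupp.linearCombination_single, one_smul, dif_neg h]

/-- The elements `y ∖ b`, `y`, `z ∖ b`, `z` form a square, so the anticommutation of signs in
`sign_other` applies to the deletion of `b`. -/
theorem CubeIdx.delete_eq_other {k : ℕ} {y : CubeIdx e (k + 1)} {b : Fin r} (h : b ∈ e y.elt)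
    (z : Cover y) (hz : b ∈ e z.idx.elt) :
    (z.idx.delete b hz).elt = other e (y.delete b h).elt y.elt z.idx.elt := by
  obtain ⟨a, ha, haz⟩ := (covBy_iff_exists_insert e).1 z.covBy
  apply e.injective
  rw [apply_delete, other, OrderIso.apply_symm_apply, apply_delete, ← haz]
  ext c
  simp only [Finset.mem_erase, Finset.mem_union, Finset.mem_sdiff, Finset.mem_insert]
  grind

/-- Among the covers of `y ∖ b`, the element `y` itself occurs with a squared sign, hence with
coefficient `1`; the remaining covers are the error term. -/
theorem cubeInt_cubeDelete_of_mem {b : Fin r} {k : ℕ} {y : CubeIdx e k} (h : b ∈ e y.elt) :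
    cubeInt e k (cubeDelete e b k (Finsupp.single y 1)) = Finsupp.single y 1 +
      ∑ w ∈ Finset.univ.erase (y.deleteCover b h),
        (sign e (y.delete b h).elt y.elt * sign e (y.delete b h).elt w.idx.elt) •
          Finsupp.single w.idx 1 := by
  rw [cubeDelete_of_mem h, map_smul, cubeInt_single, Finset.smul_sum,
    ← Finset.add_sum_erase _ _ (Finset.mem_univ (y.deleteCover b h))]
  simp only [smul_smul]
  congr 1
  change (sign e _ y.elt * sign e _ y.elt) • Finsupp.single y 1 = _
  rw [sign_mul_self e (y.delete_covBy b h), one_smul]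

theorem CubeIdx.apply_eq_univ (y : CubeIdx e 0) : e y.elt = Finset.univ := by
  rw [← Finset.card_eq_iff_eq_univ, Fintype.card_fin]
  exact y.card_add

theorem cubeInt_cubeDelete_zero (b : Fin r) (y : CubeIdx e 0) :
    cubeInt e 0 (cubeDelete e b 0 (Finsupp.single y 1)) = Finsupp.single y 1 := by
  have h : b ∈ e y.elt := by rw [y.apply_eq_univ]; exact Finset.mem_univ b
  rw [cubeInt_cubeDelete_of_mem h, Finset.sum_eq_zero, add_zero]
  intro w hw
  exact absurd (Cover.ext_apply (w.idx.apply_eq_univ.trans (CubeIdx.apply_eq_univ _).symm))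
    (Finset.mem_erase.1 hw).1

/-- The cube is the product of an edge in direction `b` with a smaller cube, and deleting `b`
contracts the edge. If `b` lies below `y`, the error terms cancel in pairs around squares; otherwise
only the edge from `y` to `y ∨ b` contributes. -/
theorem cubeInt_cubeDelete_succ (b : Fin r) {k : ℕ} (y : CubeIdx e (k + 1)) :
    cubeInt e (k + 1) (cubeDelete e b (k + 1) (Finsupp.single y 1)) +
      cubeDelete e b k (cubeInt e k (Finsupp.single y 1)) = Finsupp.single y 1 := by
  by_cases h : b ∈ e y.elt
  · have hz : ∀ z : Cover y, b ∈ e z.idx.elt := fun z => e.monotone z.covBy.le h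
    rw [cubeInt_cubeDelete_of_mem h, add_assoc, add_eq_left, cubeInt_single, map_sum,
      add_eq_zero_iff_neg_eq, ← Finset.sum_neg_distrib]
    symm
    -- Covers `z` of `y` correspond to the covers of `y ∖ b` other than `y` through `z ↦ z ∖ b`,
    -- with inverse adding `b` back.
    refine Finset.sum_bij (fun z _ => ⟨z.idx.delete b (hz z), ?_⟩) ?_ ?_ ?_ ?_
    · rw [CubeIdx.delete_eq_other h]
      exact covBy_other e (y.delete_covBy b h) z.covBy
    · intro z _
      refine Finset.mem_erase.2 ⟨fun heq => ?_, Finset.mem_univ _⟩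
      refine other_ne e (y.delete_covBy b h) z.covBy ?_
      rw [← CubeIdx.delete_eq_other h z (hz z)]
      exact congrArg (fun w => w.idx.elt) heq
    · intro z _ z' _ heq
      have h1 := congrArg (fun w : Cover (y.delete b h) => insert b (e w.idx.elt)) heq
      simp only [CubeIdx.apply_delete, Finset.insert_erase (hz _)] at h1
      exact Cover.ext_apply h1
    · intro w hw
      obtain ⟨a, ha, haw⟩ := (covBy_iff_exists_insert e).1 w.covBy
      have hab : a ≠ b := by
        rintro rfl
        refine (Finset.mem_erase.1 hw).1 (Cover.ext_apply ?_)
        rw [← haw, CubeIdx.apply_delete, Finset.insert_erase h]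
        rfl
      rw [CubeIdx.apply_delete] at ha haw
      have hay : a ∉ e y.elt := fun h' => ha (Finset.mem_erase.2 ⟨hab, h'⟩)
      have hcard := y.card_add
      refine ⟨⟨⟨e.symm (insert a (e y.elt)), ?_⟩, ?_⟩, Finset.mem_univ _, Cover.ext_apply ?_⟩
      · rw [OrderIso.apply_symm_apply, Finset.card_insert_of_notMem hay]
        omega
      · rw [covBy_iff_exists_insert e]
        exact ⟨a, hay, (OrderIso.apply_symm_apply _ _).symm⟩
      · rw [CubeIdx.apply_delete, OrderIso.apply_symm_apply, ← haw,
          Finset.erase_insert_of_ne hab]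
    · intro z _
      rw [map_smul, cubeDelete_of_mem (hz z), smul_smul, ← neg_smul]
      congr 1
      have h1 := sign_other e (y.delete_covBy b h) z.covBy
      rw [← CubeIdx.delete_eq_other h z (hz z)] at h1
      have h2 := sign_mul_self e (y.delete_covBy b h)
      have h3 := sign_mul_self e (z.idx.delete_covBy b (hz z))
      change _ = -(sign e (y.delete b h).elt y.elt * sign e (y.delete b h).elt
        (z.idx.delete b (hz z)).elt)
      -- Multiply the anticommutation relation of the square by the signs of its two edges in
      -- direction `b`, whose squares are `1`.
      linear_combination (sign e (y.delete b h).elt y.elt *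
        sign e (z.idx.delete b (hz z)).elt z.idx.elt) * h1 -
        (sign e (y.delete b h).elt y.elt * sign e (y.delete b h).elt
        (z.idx.delete b (hz z)).elt) * h3 -
        (sign e y.elt z.idx.elt * sign e (z.idx.delete b (hz z)).elt z.idx.elt) * h2
  · rw [cubeDelete_of_notMem h, map_zero, zero_add, cubeInt_single, map_sum]
    have hcard := y.card_add
    have hb : (e (e.symm (insert b (e y.elt)))).card + k = r := by
      rw [OrderIso.apply_symm_apply, Finset.card_insert_of_notMem h]
      omega
    have hcov : y.elt ⋖ e.symm (insert b (e y.elt)) := by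
      rw [covBy_iff_exists_insert e]
      exact ⟨b, h, (OrderIso.apply_symm_apply _ _).symm⟩
    let z : Cover y := ⟨⟨e.symm (insert b (e y.elt)), hb⟩, hcov⟩
    have hz : e z.idx.elt = insert b (e y.elt) := OrderIso.apply_symm_apply _ _
    have hbz : b ∈ e z.idx.elt := hz ▸ Finset.mem_insert_self _ _
    -- Deletion of `b` kills every cover of `y` that does not contain `b`, so only `z = y ∨ b`
    -- survives.
    rw [Finset.sum_eq_single z]
    · have hdel : z.idx.delete b hbz = y := by
        apply CubeIdx.ext_apply
        rw [CubeIdx.apply_delete, hz, Finset.erase_insert h]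
      rw [map_smul, cubeDelete_of_mem hbz, smul_smul, hdel, sign_mul_self e z.covBy, one_smul]
    · intro w _ hw
      rw [map_smul, cubeDelete_of_notMem, smul_zero]
      intro hbw
      obtain ⟨a, ha, haw⟩ := (covBy_iff_exists_insert e).1 w.covBy
      rw [← haw, Finset.mem_insert, or_iff_left h] at hbw
      subst hbw
      exact hw (Cover.ext_apply (by rw [← haw, hz]))
    · exact fun h => absurd (Finset.mem_univ _) h

/-- An element above `z` stays above `z` after losing `b` exactly because `b` is not below `z`. -/
theorem cubeDelete_mem {z : B} {b : Fin r} (hb : b ∉ e z) (k : ℕ) (c : CubeIdx e k →₀ ℤ)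
    (hc : c ∈ above CubeIdx.elt z) : cubeDelete e b k c ∈ above CubeIdx.elt z := by
  refine above_induction (p := fun c => cubeDelete e b k c ∈ above CubeIdx.elt z)
    (fun y hy => ?_) (by simp) (fun x y hx hy => by rw [map_add]; exact add_mem hx hy)
    (fun n x hx => by rw [map_smul]; exact Submodule.smul_mem _ _ hx) hc
  by_cases h : b ∈ e y.elt
  · rw [cubeDelete_of_mem h]
    refine Submodule.smul_mem _ _ (single_mem_above ?_ 1)
    rw [← e.le_iff_le, CubeIdx.apply_delete]
    exact Finset.subset_erase.2 ⟨e.monotone hy, hb⟩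
  · rw [cubeDelete_of_notMem h]
    exact zero_mem _

/-- The part of the integral cube complex above `z` is contracted by deleting an atom
that is not below `z`. -/
def cubeContraction {z : B} {b : Fin r} (hb : b ∉ e z) : (cubeUpper e).Contraction z where
  s := cubeDelete e b
  s_mem := cubeDelete_mem hb
  d_s_zero := fun _ hc => map_eq_of_eq_on_above (cubeInt e 0 ∘ₗ cubeDelete e b 0) LinearMap.id
    (fun y _ => cubeInt_cubeDelete_zero b y) hc
  d_s_succ := fun k _ hc => map_eq_of_eq_on_above
    (cubeInt e (k + 1) ∘ₗ cubeDelete e b (k + 1) + cubeDelete e b k ∘ₗ cubeInt e k) LinearMap.id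
    (fun y _ => cubeInt_cubeDelete_succ b y) hc

variable [OrderTop B]

theorem exists_notMem_of_ne_top {z : B} (hz : z ≠ ⊤) : ∃ b, b ∉ e z := by
  by_contra! h
  exact hz (top_unique (e.le_iff_le.1 fun b _ => h b))

theorem CubeIdx.elt_ne_top {k : ℕ} (x : CubeIdx e (k + 1)) : x.elt ≠ ⊤ := by
  intro h
  have h1 := x.card_add
  rw [h, e.map_top, Finset.top_eq_univ, Finset.card_univ, Fintype.card_fin] at h1
  omega

theorem CubeIdx.elt_eq_top (x : CubeIdx e 0) : x.elt = ⊤ := by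
  apply e.injective
  rw [e.map_top, x.apply_eq_univ, Finset.top_eq_univ]

end CubeContraction

end

end ColouredPoset
namespace ColouredPoset

noncomputable section

/-! ### The integral form of `phi` and the homotopy equivalence -/

section PhiInt

variable {B : Type u} [PartialOrder B] [OrderTop B] {r : ℕ} (e : B ≃o Finset (Fin r))

/-- The map `phi` on integral chains. -/
def phiInt (k : ℕ) : (CubeIdx e k →₀ ℤ) →ₗ[ℤ] (OrdSeq B k →₀ ℤ) :=
  Finsupp.linearCombination ℤ fun x =>
    ∑ c : SatSeq x, seqSign e c.ord • Finsupp.single c.ord 1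

theorem phiInt_single (k : ℕ) (x : CubeIdx e k) :
    phiInt e k (Finsupp.single x 1) =
      ∑ c : SatSeq x, seqSign e c.ord • Finsupp.single c.ord 1 := by
  rw [phiInt, Finsupp.linearCombination_single, one_smul]

theorem phiInt_upper (k : ℕ) :
    IsUpper (CubeIdx.elt (e := e) (k := k)) OrdSeq.first (phiInt e k) := fun x => by
  rw [phiInt_single]
  exact sum_mem fun c _ => Submodule.smul_mem _ _ (single_mem_above c.first_eq.ge 1)

theorem phiMap_eq {R : Type w} [CommRing R] (F : B ⥤ ModuleCat.{v} R) (k : ℕ) :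
    phiMap e F k = ModuleCat.ofHom (realize F CubeIdx.elt OrdSeq.first (phiInt e k)) := by
  rw [phiMap, realize]
  congr 2
  funext x
  rw [phiInt_single, map_sum]
  refine Finset.sum_congr rfl fun c _ => ?_
  rw [map_smul, realizeChain_single F _ c.first_eq.ge]

theorem phiInt_comm (k : ℕ) : chainInt k ∘ₗ phiInt e (k + 1) = phiInt e k ∘ₗ cubeInt e k := by
  apply realize_constRat_injective ((chainInt_upper k).comp (phiInt_upper e (k + 1)))
    ((phiInt_upper e k).comp (cubeInt_upper e k))
  rw [realize_comp _ (chainInt_upper k) (phiInt_upper e (k + 1)),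
    realize_comp _ (phiInt_upper e k) (cubeInt_upper e k)]
  have h := phiMap_comm e (constRat B) k
  rw [phiMap_eq, phiMap_eq, chainDifferential_eq, cubeDifferential_eq, ← ModuleCat.ofHom_comp,
    ← ModuleCat.ofHom_comp] at h
  exact congrArg ModuleCat.Hom.hom h

variable (B) in
/-- The empty sequence in `B ∖ 1`. -/
def OrdSeq.nil : OrdSeq B 0 := ⟨fun _ => ⊤, fun i j h => by omega, rfl⟩

theorem OrdSeq.eq_nil (x : OrdSeq B 0) : x = OrdSeq.nil B := by
  apply OrdSeq.ext
  funext i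
  rw [show i = Fin.last 0 by omega, x.last_eq]
  rfl

/-- The maximal element of the Boolean lattice. -/
def CubeIdx.top : CubeIdx e 0 := ⟨⊤, by simp⟩

theorem CubeIdx.eq_top (x : CubeIdx e 0) : x = CubeIdx.top e :=
  CubeIdx.ext x.elt_eq_top

/-- The only saturated sequence from `⊤` to `⊤` has no steps, and its sign is an empty product. -/
theorem phiInt_zero (x : CubeIdx e 0) :
    phiInt e 0 (Finsupp.single x 1) = Finsupp.single (OrdSeq.nil B) 1 := by
  rw [phiInt_single, Fintype.sum_eq_single
    (⟨OrdSeq.nil B, x.elt_eq_top.symm, fun i => i.elim0⟩ : SatSeq x)]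
  · simp [seqSign]
  · intro c hc
    exact absurd (SatSeq.ext c.ord.eq_nil) hc

/-- The inverse of `phiInt` in degree `0`. -/
def phiIntInv : (OrdSeq B 0 →₀ ℤ) →ₗ[ℤ] (CubeIdx e 0 →₀ ℤ) :=
  Finsupp.linearCombination ℤ fun _ => Finsupp.single (CubeIdx.top e) 1

theorem phiIntInv_single (x : OrdSeq B 0) :
    phiIntInv e (Finsupp.single x 1) = Finsupp.single (CubeIdx.top e) 1 := by
  rw [phiIntInv, Finsupp.linearCombination_single, one_smul]

theorem phiIntInv_upper : IsUpper (OrdSeq.first (P := B)) (CubeIdx.elt (e := e)) (phiIntInv e) := fun x => by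
  rw [phiIntInv_single]
  exact single_mem_above (x.first_eq_top.trans (CubeIdx.top e).elt_eq_top.symm).le 1

theorem phiInt_comp_phiIntInv : phiInt e 0 ∘ₗ phiIntInv e = LinearMap.id := by
  apply Finsupp.lhom_ext'
  intro x
  ext1
  simp only [LinearMap.comp_apply, Finsupp.lsingle_apply, LinearMap.id_apply]
  rw [phiIntInv_single, phiInt_zero, ← x.eq_nil]

theorem phiIntInv_comp_phiInt : phiIntInv e ∘ₗ phiInt e 0 = LinearMap.id := by
  apply Finsupp.lhom_ext'
  intro x
  ext1
  simp only [LinearMap.comp_apply, Finsupp.lsingle_apply, LinearMap.id_apply]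
  rw [phiInt_zero, phiIntInv_single, ← x.eq_top]

variable {R : Type w} [CommRing R] (F : B ⥤ ModuleCat.{v} R)

/-- The acyclic models are the elements `z ≠ ⊤`: each misses an atom, which contracts the cube above
it, and is itself the apex of the cone of sequences above it. -/
theorem exists_homotopyEquiv_realizeHom_phiInt :
    ∃ h : HomotopyEquiv ((cubeUpper e).realizeCx F) ((chainUpper B).realizeCx F),
      h.hom = realizeHom F (X := cubeUpper e) (Y := chainUpper B) (phiInt e) (phiInt_upper e)
        (phiInt_comm e) :=
  exists_homotopyEquiv_realizeHom F (p := fun z : B => z ≠ ⊤)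
    (fun _ hz => cubeContraction (exists_notMem_of_ne_top (e := e) hz).choose_spec)
    chainContraction (fun _ x => CubeIdx.elt_ne_top x) (fun _ x => OrdSeq.first_ne_top x)
    (phiInt e) (phiInt_upper e) (phiInt_comm e) (phiIntInv e) (phiIntInv_upper e)
    (phiInt_comp_phiIntInv e) (phiIntInv_comp_phiInt e)

/-- The map `phi` is a homotopy equivalence for every colouring: the homotopies are defined over
the integers, so no condition on the modules `F x` is needed. -/
theorem exists_homotopyEquiv_phi :
    ∃ h : HomotopyEquiv (cubeCx e F) (chainCx F), h.hom = phi e F := by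
  -- The given differentials equal the realized integral ones only by a proof. With the
  -- differentials as variables, these equalities can be substituted, which identifies the complexes
  -- without transport maps.
  have key : ∀ (dX : ∀ k, cubeModule e F (k + 1) ⟶ cubeModule e F k)
      (dY : ∀ k, chainModule F (k + 1) ⟶ chainModule F k)
      (hX : ∀ k, dX (k + 1) ≫ dX k = 0) (hY : ∀ k, dY (k + 1) ≫ dY k = 0)
      (_ : dX = (cubeUpper e).realizeDifferential F)
      (_ : dY = (chainUpper B).realizeDifferential F)
      (f : ChainComplex.of (cubeModule e F) dX hX ⟶ ChainComplex.of (chainModule F) dY hY)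
      (_ : ∀ k, f.f k = phiMap e F k),
      ∃ h : HomotopyEquiv (ChainComplex.of (cubeModule e F) dX hX)
        (ChainComplex.of (chainModule F) dY hY), h.hom = f := by
    rintro _ _ hX hY rfl rfl f hf
    obtain ⟨h, hh⟩ := exists_homotopyEquiv_realizeHom_phiInt e F
    refine ⟨h, hh.trans ?_⟩
    ext1 k
    exact ((hf k).trans (phiMap_eq e F k)).symm
  exact key _ _ (cubeDifferential_comp e F) (chainDifferential_comp F)
    (funext (cubeDifferential_eq e F)) (funext (chainDifferential_eq F)) (phi e F) fun _ => rfl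

end PhiInt

end

end ColouredPoset

/-- `B` is a finite Boolean lattice of rank `r` whose atoms are ordered, through the isomorphism
`e` with the lattice of subsets of `{0, ..., r - 1}`, and `F` is a colouring of `B` by
`R`-modules. -/
theorem corollary5p4 {R : Type w} [CommRing R] {B : Type u} [PartialOrder B] [OrderTop B] {r : ℕ}
    (e : B ≃o Finset (Fin r)) (F : B ⥤ ModuleCat.{v} R) :
    ((∀ x : B, Module.Projective R (F.obj x)) →
      ∃ h : HomotopyEquiv (ColouredPoset.cubeCx e F) (ColouredPoset.chainCx F),
        h.hom = ColouredPoset.phi e F) ∧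
    (IsField R →
      ∃ h : HomotopyEquiv (ColouredPoset.cubeCx e F) (ColouredPoset.chainCx F),
        h.hom = ColouredPoset.phi e F) := by
  exact ⟨fun _ => ColouredPoset.exists_homotopyEquiv_phi e F,
    fun _ => ColouredPoset.exists_homotopyEquiv_phi e F⟩
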